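/- Let $H$ be a finite-dimensional Hopf algebra over $\mathbb{C}$ (for instance a finite-dimensional $C^*$ Hopf algebra) and let $\mathsf{Rep}(H)$ be the monoidal category of its finite-dimensional representations. All modules and bimodules below are finite-dimensional. (1) Let $\mathfrak{A}$ and $\mathfrak{B}$ be finite-dimensional left $H$-comodule algebras, with coactions $a\mapsto \sum a^{[-1]}\otimes a^{[0]}$. The category ${}_{\mathfrak{A}}\mathsf{Mod}$ of left $\mathfrak{A}$-modules is a left $\mathsf{Rep}(H)$-module category, where $\mathfrak{A}$ acts on $X\otimes M$ by $a(x\otimes m)=\sum a^{[-1]}x\otimes a^{[0]}m$. The boundary models determined by $\mathfrak{A}$ and $\mathfrak{B}$ are called topologically equivalent if ${}_{\mathfrak{A}}\mathsf{Mod}$ and ${}_{\mathfrak{B}}\mathsf{Mod}$ are equivalent as ($\mathbb{C}$-linear) left $\mathsf{Rep}(H)$-module categories. An $H$-covariant $\mathfrak{A}|\mathfrak{B}$-bimodule is an $\mathfrak{A}|\mathfrak{B}$-bimodule $P$ with a left $H$-comodule structure such that $\sum (apb)^{[-1]}\otimes (apb)^{[0]}=\sum a^{[-1]}p^{[-1]}b^{[-1]}\otimes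 a^{[0]}p^{[0]}b^{[0]}$, and $\mathfrak{A}$, $\mathfrak{B}$ are called equivariantly Morita equivalent if there are an $H$-covariant $\mathfrak{A}|\mathfrak{B}$-bimodule $P$ and an $H$-covariant $\mathfrak{B}|\mathfrak{A}$-bimodule $Q$ with $P\otimes_{\mathfrak{B}}Q\cong\mathfrak{A}$ and $Q\otimes_{\mathfrak{A}}P\cong\mathfrak{B}$ as $H$-covariant bimodules, where $P\otimes_{\mathfrak B}Q$ has the coaction $p\otimes q\mapsto\sum p^{[-1]}q^{[-1]}\otimes p^{[0]}\otimes q^{[0]}$ (similarly for $Q\otimes_{\mathfrak A}P$). Then the boundary models determined by $\mathfrak{A}$ and $\mathfrak{B}$ are topologically equivalent if and only if $\mathfrak{A}$ and $\mathfrak{B}$ are equivariantly Morita equivalent. (2) Let $\mathfrak{M}$ and $\mathfrak{N}$ be finite-dimensional left $H$-module algebras, that is, algebras in $\mathsf{Rep}(H)$. The category $\mathsf{Rep}(H)_{\mathfrak{M}}$ of right $\mathfrak{M}$-modules in $\mathsf{Rep}(H)$ is a left $\mathsf{Rep}(H)$-module category under the tensor product, $\mathfrak M$ acting on $X\otimes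 V$ through $V$. The boundary models determined by $\mathfrak{M}$ and $\mathfrak{N}$ are called topologically equivalent if $\mathsf{Rep}(H)_{\mathfrak{M}}$ and $\mathsf{Rep}(H)_{\mathfrak{N}}$ are equivalent as ($\mathbb{C}$-linear) left $\mathsf{Rep}(H)$-module categories, and $\mathfrak{M}$, $\mathfrak{N}$ are called equivariantly Morita equivalent if there are an $\mathfrak{M}|\mathfrak{N}$-bimodule $P$ and an $\mathfrak{N}|\mathfrak{M}$-bimodule $Q$ in $\mathsf{Rep}(H)$ with $P\otimes_{\mathfrak{N}}Q\cong\mathfrak{M}$ and $Q\otimes_{\mathfrak{M}}P\cong\mathfrak{N}$ as bimodules in $\mathsf{Rep}(H)$. Then the boundary models determined by $\mathfrak{M}$ and $\mathfrak{N}$ are topologically equivalent if and only if $\mathfrak{M}$ and $\mathfrak{N}$ are equivariantly Morita equivalent. -/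

import Mathlib

open CategoryTheory MonoidalCategory
open scoped TensorProduct

universe u

noncomputable section

namespace HopfBoundary

section TensorRep

variable {H A X Y M : Type u} [Ring H] [Ring A] [Algebra ℂ A]
  [AddCommGroup X] [Module ℂ X] [AddCommGroup Y] [Module ℂ Y] [AddCommGroup M] [Module ℂ M]

/-- Given `β : A → H ⊗ A`, a representation `ρX` of `H` on `X` and a representation `ρM` of `A`
on `M`, the action of `A` on `X ⊗ M` by `a • (x ⊗ m) = ∑ a⁽⁻¹⁾ x ⊗ a⁽⁰⁾ m`, where
`β a = ∑ a⁽⁻¹⁾ ⊗ a⁽⁰⁾`. For `A = H` and `β = Δ` this is the usual tensor product of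
representations. -/
def tensorRep [Algebra ℂ H] (β : A →ₐ[ℂ] H ⊗[ℂ] A) (ρX : H →ₐ[ℂ] Module.End ℂ X)
    (ρM : A →ₐ[ℂ] Module.End ℂ M) : A →ₐ[ℂ] Module.End ℂ (X ⊗[ℂ] M) :=
  (Module.endTensorEndAlgHom (R := ℂ) (S := ℂ) (A := ℂ)).comp
    ((Algebra.TensorProduct.map ρX ρM).comp β)

theorem tensorRep_map [Algebra ℂ H] (β : A →ₐ[ℂ] H ⊗[ℂ] A) {X' M' : Type u}
    [AddCommGroup X'] [Module ℂ X'] [AddCommGroup M'] [Module ℂ M']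
    (ρX : H →ₐ[ℂ] Module.End ℂ X) (ρM : A →ₐ[ℂ] Module.End ℂ M)
    (ρX' : H →ₐ[ℂ] Module.End ℂ X') (ρM' : A →ₐ[ℂ] Module.End ℂ M')
    (f : X →ₗ[ℂ] X') (g : M →ₗ[ℂ] M')
    (hf : ∀ h, f ∘ₗ ρX h = ρX' h ∘ₗ f) (hg : ∀ a, g ∘ₗ ρM a = ρM' a ∘ₗ g) (a : A) :
    TensorProduct.map f g ∘ₗ tensorRep β ρX ρM a =
      tensorRep β ρX' ρM' a ∘ₗ TensorProduct.map f g := by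
  simp only [tensorRep, AlgHom.comp_apply]
  generalize β a = t
  induction t with
  | zero => simp
  | add s t hs ht => simp only [map_add, LinearMap.comp_add, LinearMap.add_comp, hs, ht]
  | tmul h b =>
    simp only [Algebra.TensorProduct.map_tmul, Module.endTensorEndAlgHom_apply]
    ext x m
    have h1 := LinearMap.congr_fun (hf h) x
    have h2 := LinearMap.congr_fun (hg b) m
    simp only [LinearMap.comp_apply] at h1 h2
    simp [TensorProduct.AlgebraTensorModule.map_tmul, h1, h2]

theorem tensorRep_assoc [Bialgebra ℂ H] (β : A →ₐ[ℂ] H ⊗[ℂ] A)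
    (hβ : ∀ a, TensorProduct.assoc ℂ H H A (Coalgebra.comul.rTensor A (β a)) =
      β.toLinearMap.lTensor H (β a))
    (ρX : H →ₐ[ℂ] Module.End ℂ X) (ρY : H →ₐ[ℂ] Module.End ℂ Y)
    (ρM : A →ₐ[ℂ] Module.End ℂ M) (a : A) :
    (TensorProduct.assoc ℂ X Y M).toLinearMap ∘ₗ
        tensorRep β (tensorRep (Bialgebra.comulAlgHom ℂ H) ρX ρY) ρM a =
      tensorRep β ρX (tensorRep β ρY ρM) a ∘ₗ (TensorProduct.assoc ℂ X Y M).toLinearMap := by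
  let T : H ⊗[ℂ] (H ⊗[ℂ] A) →ₗ[ℂ] Module.End ℂ (X ⊗[ℂ] (Y ⊗[ℂ] M)) :=
    ((Module.endTensorEndAlgHom (R := ℂ) (S := ℂ) (A := ℂ)).comp
      (Algebra.TensorProduct.map ρX
        ((Module.endTensorEndAlgHom (R := ℂ) (S := ℂ) (A := ℂ)).comp
          (Algebra.TensorProduct.map ρY ρM)))).toLinearMap
  have hR : tensorRep β ρX (tensorRep β ρY ρM) a = T (β.toLinearMap.lTensor H (β a)) := by
    simp only [tensorRep, AlgHom.comp_apply]
    generalize β a = t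
    induction t with
    | zero => simp
    | add s t hs ht => simp only [map_add, hs, ht]
    | tmul h b => rfl
  have hL : ∀ t : H ⊗[ℂ] A, (TensorProduct.assoc ℂ X Y M).toLinearMap ∘ₗ
      Module.endTensorEndAlgHom (R := ℂ) (S := ℂ) (A := ℂ) (Algebra.TensorProduct.map
        (tensorRep (Bialgebra.comulAlgHom ℂ H) ρX ρY) ρM t) =
      T (TensorProduct.assoc ℂ H H A (Coalgebra.comul.rTensor A t)) ∘ₗ
        (TensorProduct.assoc ℂ X Y M).toLinearMap := by
    intro t
    induction t with
    | zero => simp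
    | add s t hs ht => simp only [map_add, LinearMap.comp_add, LinearMap.add_comp, hs, ht]
    | tmul h b =>
      simp only [Algebra.TensorProduct.map_tmul, Module.endTensorEndAlgHom_apply,
        LinearMap.rTensor_tmul, tensorRep, AlgHom.comp_apply, Bialgebra.comulAlgHom_apply]
      generalize (Coalgebra.comul h : H ⊗[ℂ] H) = s
      induction s with
      | zero => ext; simp
      | add s t hs ht =>
        simp only [map_add, TensorProduct.add_tmul, LinearMap.add_comp, ← hs, ← ht]
        ext; simp [TensorProduct.add_tmul]
      | tmul h1 h2 => ext; rfl
  rw [hR, ← hβ a, ← hL]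
  rfl

end TensorRep

section Modules

/-- A finite-dimensional left module over the complex algebra `A`, given as a representation. -/
structure FDMod (A : Type u) [Ring A] [Algebra ℂ A] where
  carrier : Type u
  [addCommGroup : AddCommGroup carrier]
  [module : Module ℂ carrier]
  [finite : FiniteDimensional ℂ carrier]
  ρ : A →ₐ[ℂ] Module.End ℂ carrier

attribute [instance] FDMod.addCommGroup FDMod.module FDMod.finite

variable {A : Type u} [Ring A] [Algebra ℂ A]

/-- The space of `A`-linear maps. -/
def FDMod.homs (V W : FDMod A) : Submodule ℂ (V.carrier →ₗ[ℂ] W.carrier) where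
  carrier := {f | ∀ a, f ∘ₗ V.ρ a = W.ρ a ∘ₗ f}
  add_mem' hf hg a := by
    simp only [Set.mem_ofPred_eq] at hf hg
    rw [LinearMap.add_comp, LinearMap.comp_add, hf, hg]
  zero_mem' a := by simp
  smul_mem' c f hf a := by
    simp only [Set.mem_ofPred_eq] at hf
    rw [LinearMap.smul_comp, LinearMap.comp_smul, hf]

instance FDMod.category : Category (FDMod A) where
  Hom V W := FDMod.homs V W
  id V := ⟨LinearMap.id, fun _ => rfl⟩
  comp f g := ⟨g.1 ∘ₗ f.1, fun a => by
    rw [LinearMap.comp_assoc, f.2 a, ← LinearMap.comp_assoc, g.2 a, LinearMap.comp_assoc]⟩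

/-- The linear map underlying a morphism. -/
def FDMod.toLin {V W : FDMod A} (f : V ⟶ W) : V.carrier →ₗ[ℂ] W.carrier := Subtype.val f

theorem FDMod.hom_ext {V W : FDMod A} {f g : V ⟶ W} (h : FDMod.toLin f = FDMod.toLin g) :
    f = g := Subtype.ext h

instance FDMod.preadditive : Preadditive (FDMod A) where
  homGroup V W := inferInstanceAs (AddCommGroup (FDMod.homs V W))
  add_comp _ _ _ _ _ _ := Subtype.ext (LinearMap.comp_add _ _ _)
  comp_add _ _ _ _ _ _ := Subtype.ext (LinearMap.add_comp _ _ _)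

instance FDMod.linear : Linear ℂ (FDMod A) where
  homModule V W := inferInstanceAs (Module ℂ (FDMod.homs V W))
  smul_comp _ _ _ _ _ _ := Subtype.ext (LinearMap.comp_smul _ _ _)
  comp_smul _ _ _ _ _ _ := Subtype.ext (LinearMap.smul_comp _ _ _)

/-- A morphism of modules from an `A`-linear map. -/
def FDMod.mkHom {V W : FDMod A} (f : V.carrier →ₗ[ℂ] W.carrier)
    (hf : ∀ a, f ∘ₗ V.ρ a = W.ρ a ∘ₗ f) : V ⟶ W := ⟨f, hf⟩

/-- An isomorphism of modules from a bijective `A`-linear map. -/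
def FDMod.mkIso {V W : FDMod A} (e : V.carrier ≃ₗ[ℂ] W.carrier)
    (he : ∀ a, e.toLinearMap ∘ₗ V.ρ a = W.ρ a ∘ₗ e.toLinearMap) : V ≅ W where
  hom := FDMod.mkHom e.toLinearMap he
  inv := FDMod.mkHom e.symm.toLinearMap fun a => by
    ext w
    have := LinearMap.congr_fun (he a) (e.symm w)
    simp only [LinearMap.comp_apply, LinearEquiv.coe_coe, LinearEquiv.apply_symm_apply] at this ⊢
    rw [← this, LinearEquiv.symm_apply_apply]
  hom_inv_id := Subtype.ext (LinearMap.ext fun v => e.symm_apply_apply v)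
  inv_hom_id := Subtype.ext (LinearMap.ext fun v => e.apply_symm_apply v)

end Modules

section RepH

variable {H : Type u} [Ring H] [Bialgebra ℂ H]

theorem comul_coassoc' (h : H) :
    TensorProduct.assoc ℂ H H H
        (Coalgebra.comul.rTensor H (Bialgebra.comulAlgHom ℂ H h)) =
      (Bialgebra.comulAlgHom ℂ H).toLinearMap.lTensor H (Bialgebra.comulAlgHom ℂ H h) :=
  Coalgebra.coassoc_apply h

/-- The counit of `H`, as the one-dimensional trivial representation. -/
def trivRep (H : Type u) [Ring H] [Bialgebra ℂ H] : H →ₐ[ℂ] Module.End ℂ (ULift.{u} ℂ) :=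
  (Algebra.ofId ℂ (Module.End ℂ (ULift.{u} ℂ))).comp (Bialgebra.counitAlgHom ℂ H)

/-- The canonical isomorphism `ℂ ⊗ M ≅ M`. -/
def lidEquiv (M : Type u) [AddCommGroup M] [Module ℂ M] : ULift.{u} ℂ ⊗[ℂ] M ≃ₗ[ℂ] M :=
  (TensorProduct.congr ULift.moduleEquiv (LinearEquiv.refl ℂ M)).trans (TensorProduct.lid ℂ M)

/-- The canonical isomorphism `X ⊗ ℂ ≅ X`. -/
def ridEquiv (X : Type u) [AddCommGroup X] [Module ℂ X] : X ⊗[ℂ] ULift.{u} ℂ ≃ₗ[ℂ] X :=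
  (TensorProduct.congr (LinearEquiv.refl ℂ X) ULift.moduleEquiv).trans (TensorProduct.rid ℂ X)

theorem tensorRep_lid {A M : Type u} [Ring A] [Algebra ℂ A] [AddCommGroup M] [Module ℂ M]
    (β : A →ₐ[ℂ] H ⊗[ℂ] A)
    (hβ : ∀ a, TensorProduct.lid ℂ A (Coalgebra.counit.rTensor A (β a)) = a)
    (ρM : A →ₐ[ℂ] Module.End ℂ M) (a : A) :
    (lidEquiv M).toLinearMap ∘ₗ tensorRep β (trivRep H) ρM a =
      ρM a ∘ₗ (lidEquiv M).toLinearMap := by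
  conv_rhs => rw [← hβ a]
  simp only [tensorRep, AlgHom.comp_apply]
  generalize β a = t
  induction t with
  | zero => simp
  | add s t hs ht => simp only [map_add, LinearMap.comp_add, LinearMap.add_comp, hs, ht]
  | tmul h b =>
    ext m
    simp [lidEquiv, trivRep, Algebra.ofId_apply, Module.endTensorEndAlgHom_apply,
      TensorProduct.AlgebraTensorModule.map_tmul, mul_smul]

theorem tensorRep_rid {X : Type u} [AddCommGroup X] [Module ℂ X]
    (ρX : H →ₐ[ℂ] Module.End ℂ X) (h : H) :
    (ridEquiv X).toLinearMap ∘ₗ tensorRep (Bialgebra.comulAlgHom ℂ H) ρX (trivRep H) h =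
      ρX h ∘ₗ (ridEquiv X).toLinearMap := by
  have hh : TensorProduct.rid ℂ H (Coalgebra.counit.lTensor H (Bialgebra.comulAlgHom ℂ H h)) = h := by
    rw [Bialgebra.comulAlgHom_apply, Coalgebra.lTensor_counit_comul]; simp
  conv_rhs => rw [← hh]
  simp only [tensorRep, AlgHom.comp_apply]
  generalize Bialgebra.comulAlgHom ℂ H h = t
  induction t with
  | zero => simp
  | add s t hs ht => simp only [map_add, LinearMap.comp_add, LinearMap.add_comp, hs, ht]
  | tmul h b =>
    ext m
    simp [ridEquiv, trivRep, Algebra.ofId_apply, Module.endTensorEndAlgHom_apply,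
      TensorProduct.AlgebraTensorModule.map_tmul]

/-- `Rep(H)`: the monoidal category of finite-dimensional representations of `H`. -/
instance FDMod.monoidalStruct : MonoidalCategoryStruct (FDMod H) where
  tensorObj X Y := ⟨X.carrier ⊗[ℂ] Y.carrier, tensorRep (Bialgebra.comulAlgHom ℂ H) X.ρ Y.ρ⟩
  tensorHom f g := FDMod.mkHom (TensorProduct.map (FDMod.toLin f) (FDMod.toLin g))
    (tensorRep_map _ _ _ _ _ _ _ f.2 g.2)
  whiskerLeft X _ _ g := FDMod.mkHom (TensorProduct.map LinearMap.id (FDMod.toLin g))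
    (tensorRep_map _ _ _ _ _ _ _ (fun _ => rfl) g.2)
  whiskerRight f Y := FDMod.mkHom (TensorProduct.map (FDMod.toLin f) LinearMap.id)
    (tensorRep_map _ _ _ _ _ _ _ f.2 (fun _ => rfl))
  tensorUnit := ⟨ULift.{u} ℂ, trivRep H⟩
  associator X Y Z := FDMod.mkIso (TensorProduct.assoc ℂ X.carrier Y.carrier Z.carrier)
    (tensorRep_assoc _ comul_coassoc' _ _ _)
  leftUnitor X := FDMod.mkIso (lidEquiv X.carrier)
    (tensorRep_lid _ (fun h => by
      rw [Bialgebra.comulAlgHom_apply, Coalgebra.rTensor_counit_comul]; simp) _)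
  rightUnitor X := FDMod.mkIso (ridEquiv X.carrier) (tensorRep_rid _)

instance FDMod.monoidal : MonoidalCategory (FDMod H) :=
  MonoidalCategory.ofTensorHom
    (id_tensorHom_id := fun _ _ => FDMod.hom_ext (TensorProduct.map_id))
    (id_tensorHom := fun _ _ _ _ => rfl)
    (tensorHom_id := fun _ _ => rfl)
    (tensorHom_comp_tensorHom := fun _ _ _ _ =>
      FDMod.hom_ext (TensorProduct.map_comp _ _ _ _).symm)
    (associator_naturality := fun _ _ _ =>
      FDMod.hom_ext (TensorProduct.ext_threefold fun _ _ _ => rfl))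
    (leftUnitor_naturality := fun f =>
      FDMod.hom_ext (TensorProduct.ext' fun c x => ((FDMod.toLin f).map_smul c.down x).symm))
    (rightUnitor_naturality := fun f =>
      FDMod.hom_ext (TensorProduct.ext' fun x c => ((FDMod.toLin f).map_smul c.down x).symm))
    (pentagon := fun _ _ _ _ =>
      FDMod.hom_ext (TensorProduct.ext_fourfold fun _ _ _ _ => rfl))
    (triangle := fun _ _ =>
      FDMod.hom_ext (TensorProduct.ext_threefold fun x c y =>
        (TensorProduct.smul_tmul c.down x y).symm))

end RepH

/-- Two `ℂ`-linear left module categories over a monoidal category `C` are equivalent if there is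
a `ℂ`-linear equivalence of categories that carries a structure of (strong) `C`-module functor. -/
def ModuleCatEquivalent (C : Type*) [Category* C] [MonoidalCategory C]
    (D D' : Type*) [Category* D] [Category* D'] [Preadditive D] [Preadditive D']
    [Linear ℂ D] [Linear ℂ D'] [MonoidalLeftAction C D] [MonoidalLeftAction C D'] : Prop :=
  ∃ F : D ⥤ D', F.IsEquivalence ∧ F.Additive ∧ F.Linear ℂ ∧ Nonempty (F.LeftLinear C)

section BalancedTensor

variable {R P Q : Type u} [Ring R] [Algebra ℂ R] [AddCommGroup P] [Module ℂ P]
  [AddCommGroup Q] [Module ℂ Q]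

/-- The subspace of `P ⊗ Q` spanned by all `p r ⊗ q - p ⊗ r q`. -/
def balancedRelations (ract : P →ₗ[ℂ] R →ₗ[ℂ] P) (lact : R →ₗ[ℂ] Q →ₗ[ℂ] Q) :
    Submodule ℂ (P ⊗[ℂ] Q) :=
  Submodule.span ℂ {t | ∃ p r q, t = ract p r ⊗ₜ[ℂ] q - p ⊗ₜ[ℂ] lact r q}

/-- The tensor product `P ⊗_R Q` of a right `R`-module and a left `R`-module. -/
abbrev BalancedTensor (ract : P →ₗ[ℂ] R →ₗ[ℂ] P) (lact : R →ₗ[ℂ] Q →ₗ[ℂ] Q) : Type u :=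
  (P ⊗[ℂ] Q) ⧸ balancedRelations ract lact

/-- The bilinear map `(p, q) ↦ p ⊗_R q`. -/
def balancedMk (ract : P →ₗ[ℂ] R →ₗ[ℂ] P) (lact : R →ₗ[ℂ] Q →ₗ[ℂ] Q) :
    P →ₗ[ℂ] Q →ₗ[ℂ] BalancedTensor ract lact :=
  (TensorProduct.mk ℂ P Q).compr₂ (balancedRelations ract lact).mkQ

end BalancedTensor

section ComoduleAlgebras

/-- A left `H`-comodule algebra: an algebra `A` with a coassociative and counital coaction
`β : A → H ⊗ A` that is a homomorphism of unital algebras. -/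
class ComoduleAlgebra (H A : Type u) [Ring H] [Bialgebra ℂ H] [Ring A] [Algebra ℂ A] where
  coaction : A →ₐ[ℂ] H ⊗[ℂ] A
  coassoc : ∀ a, TensorProduct.assoc ℂ H H A (Coalgebra.comul.rTensor A (coaction a)) =
    coaction.toLinearMap.lTensor H (coaction a)
  counit : ∀ a, TensorProduct.lid ℂ A (Coalgebra.counit.rTensor A (coaction a)) = a

variable (H A B : Type u) [Ring H] [Bialgebra ℂ H]
  [Ring A] [Algebra ℂ A] [ComoduleAlgebra H A] [Ring B] [Algebra ℂ B] [ComoduleAlgebra H B]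

/-- The category of finite-dimensional left `A`-modules is a left `Rep(H)`-module category, with
`A` acting on `X ⊗ M` by `a • (x ⊗ m) = ∑ a⁽⁻¹⁾ x ⊗ a⁽⁰⁾ m`. -/
instance comoduleAlgebraActionStruct :
    MonoidalLeftActionStruct (FDMod H) (FDMod A) where
  actionObj X M := ⟨X.carrier ⊗[ℂ] M.carrier, tensorRep ComoduleAlgebra.coaction X.ρ M.ρ⟩
  actionHom f g := FDMod.mkHom (TensorProduct.map (FDMod.toLin f) (FDMod.toLin g))
    (tensorRep_map _ _ _ _ _ _ _ f.2 g.2)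
  actionHomRight _ _ _ g := FDMod.mkHom (TensorProduct.map LinearMap.id (FDMod.toLin g))
    (tensorRep_map _ _ _ _ _ _ _ (fun _ => rfl) g.2)
  actionHomLeft f _ := FDMod.mkHom (TensorProduct.map (FDMod.toLin f) LinearMap.id)
    (tensorRep_map _ _ _ _ _ _ _ f.2 (fun _ => rfl))
  actionAssocIso X Y M := FDMod.mkIso (TensorProduct.assoc ℂ X.carrier Y.carrier M.carrier)
    (tensorRep_assoc _ ComoduleAlgebra.coassoc _ _ _)
  actionUnitIso M := FDMod.mkIso (lidEquiv M.carrier)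
    (tensorRep_lid _ ComoduleAlgebra.counit _)

instance comoduleAlgebraAction : MonoidalLeftAction (FDMod H) (FDMod A) where
  actionHom_def _ _ := FDMod.hom_ext (TensorProduct.ext' fun _ _ => rfl)
  actionHomRight_id _ _ := FDMod.hom_ext TensorProduct.map_id
  id_actionHomLeft _ _ := FDMod.hom_ext TensorProduct.map_id
  actionHom_comp _ _ _ _ := FDMod.hom_ext (TensorProduct.map_comp _ _ _ _)
  actionAssocIso_hom_naturality _ _ _ :=
    FDMod.hom_ext (TensorProduct.ext_threefold fun _ _ _ => rfl)
  actionUnitIso_hom_naturality f :=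
    FDMod.hom_ext (TensorProduct.ext' fun c x => (FDMod.toLin f).map_smul c.down x)
  whiskerLeft_actionHomLeft _ _ _ _ _ :=
    FDMod.hom_ext (TensorProduct.ext_threefold fun _ _ _ => rfl)
  whiskerRight_actionHomLeft _ _ _ :=
    FDMod.hom_ext (TensorProduct.ext_threefold fun _ _ _ => rfl)
  associator_actionHom _ _ _ _ :=
    FDMod.hom_ext (TensorProduct.ext_fourfold fun _ _ _ _ => rfl)
  leftUnitor_actionHom _ _ :=
    FDMod.hom_ext (TensorProduct.ext_threefold fun _ _ _ => rfl)
  rightUnitor_actionHom _ _ :=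
    FDMod.hom_ext (TensorProduct.ext_threefold fun x c y => TensorProduct.smul_tmul c.down x y)

/-- A finite-dimensional `H`-covariant `A|B`-bimodule: an `A|B`-bimodule `P` with a left
`H`-coaction `δ` such that `δ (a p b) = β(a) δ(p) β(b)`. -/
structure CovariantBimodule where
  carrier : Type u
  [addCommGroup : AddCommGroup carrier]
  [module : Module ℂ carrier]
  [finite : FiniteDimensional ℂ carrier]
  lact : A →ₗ[ℂ] carrier →ₗ[ℂ] carrier
  one_lact : ∀ p, lact 1 p = p
  mul_lact : ∀ a a' p, lact (a * a') p = lact a (lact a' p)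
  ract : carrier →ₗ[ℂ] B →ₗ[ℂ] carrier
  ract_one : ∀ p, ract p 1 = p
  ract_mul : ∀ p b b', ract p (b * b') = ract (ract p b) b'
  lact_ract : ∀ a p b, lact a (ract p b) = ract (lact a p) b
  δ : carrier →ₗ[ℂ] H ⊗[ℂ] carrier
  coassoc : ∀ p, TensorProduct.assoc ℂ H H carrier (Coalgebra.comul.rTensor carrier (δ p)) =
    δ.lTensor H (δ p)
  counit : ∀ p, TensorProduct.lid ℂ carrier (Coalgebra.counit.rTensor carrier (δ p)) = p
  δ_lact : ∀ a p, δ (lact a p) =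
    TensorProduct.map₂ (LinearMap.mul ℂ H) lact (ComoduleAlgebra.coaction a) (δ p)
  δ_ract : ∀ p b, δ (ract p b) =
    TensorProduct.map₂ (LinearMap.mul ℂ H) ract (δ p) (ComoduleAlgebra.coaction b)

attribute [instance] CovariantBimodule.addCommGroup CovariantBimodule.module
  CovariantBimodule.finite

variable {H A B}

/-- `P ⊗_B Q ≅ A` as `H`-covariant `A|A`-bimodules. Here `A` acts on `P ⊗_B Q` through the left
action on `P` and the right action on `Q`, and the coaction is
`p ⊗ q ↦ ∑ p⁽⁻¹⁾ q⁽⁻¹⁾ ⊗ (p⁽⁰⁾ ⊗ q⁽⁰⁾)`. -/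
def CovariantBimodule.TensorIsoRegular (P : CovariantBimodule H A B)
    (Q : CovariantBimodule H B A) : Prop :=
  ∃ e : BalancedTensor P.ract Q.lact ≃ₗ[ℂ] A,
    (∀ a p q, e (balancedMk P.ract Q.lact (P.lact a p) q) =
      a * e (balancedMk P.ract Q.lact p q)) ∧
    (∀ p q a, e (balancedMk P.ract Q.lact p (Q.ract q a)) =
      e (balancedMk P.ract Q.lact p q) * a) ∧
    (∀ p q, ComoduleAlgebra.coaction (e (balancedMk P.ract Q.lact p q)) =
      e.toLinearMap.lTensor H (TensorProduct.map₂ (LinearMap.mul ℂ H)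
        (balancedMk P.ract Q.lact) (P.δ p) (Q.δ q)))

variable (H A B)

/-- Equivariant Morita equivalence of `H`-comodule algebras: there are `H`-covariant bimodules
`P` and `Q` with `P ⊗_B Q ≅ A` and `Q ⊗_A P ≅ B` as `H`-covariant bimodules. -/
def ComoduleAlgebra.EquivariantlyMoritaEquivalent : Prop :=
  ∃ (P : CovariantBimodule H A B) (Q : CovariantBimodule H B A),
    P.TensorIsoRegular Q ∧ Q.TensorIsoRegular P

/-- The boundaries determined by two `H`-comodule algebras `A` and `B` are topologically
equivalent: the `Rep(H)`-module categories of `A`-modules and `B`-modules are equivalent. -/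
def ComoduleAlgebra.TopologicallyEquivalent : Prop :=
  ModuleCatEquivalent (FDMod H) (FDMod A) (FDMod B)

end ComoduleAlgebras

section ModuleAlgebras

/-- A left `H`-module algebra: an algebra `M` with an action of `H` such that
`h (x y) = ∑ (h₁ x) (h₂ y)` and `h 1 = ε(h) 1`. -/
class ModuleAlgebra (H M : Type u) [Ring H] [Bialgebra ℂ H] [Ring M] [Algebra ℂ M] where
  act : H →ₐ[ℂ] Module.End ℂ M
  act_mul : ∀ h, act h ∘ₗ LinearMap.mul' ℂ M =
    LinearMap.mul' ℂ M ∘ₗ tensorRep (Bialgebra.comulAlgHom ℂ H) act act h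
  act_one : ∀ h, act h 1 = (Coalgebra.counit h : ℂ) • (1 : M)

variable (H M N : Type u) [Ring H] [Bialgebra ℂ H]
  [Ring M] [Algebra ℂ M] [ModuleAlgebra H M] [Ring N] [Algebra ℂ N] [ModuleAlgebra H N]

/-- A right `M`-module in `Rep(H)`: a finite-dimensional representation `V` of `H` with a right
action of `M` such that `h (v m) = ∑ (h₁ v) (h₂ m)`. -/
structure RightModRep extends FDMod H where
  ract : carrier →ₗ[ℂ] M →ₗ[ℂ] carrier
  ract_one : ∀ v, ract v 1 = v
  ract_mul : ∀ v m m', ract v (m * m') = ract (ract v m) m'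
  equivariant : ∀ h, ρ h ∘ₗ TensorProduct.lift ract =
    TensorProduct.lift ract ∘ₗ tensorRep (Bialgebra.comulAlgHom ℂ H) ρ ModuleAlgebra.act h

variable {H M}

/-- The space of linear maps that are both `H`-linear and `M`-linear. -/
def RightModRep.homs (V W : RightModRep H M) : Submodule ℂ (V.carrier →ₗ[ℂ] W.carrier) where
  carrier := {f | (∀ h, f ∘ₗ V.ρ h = W.ρ h ∘ₗ f) ∧ ∀ v m, f (V.ract v m) = W.ract (f v) m}
  add_mem' := by
    rintro f g ⟨hf, hf'⟩ ⟨hg, hg'⟩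
    refine ⟨fun a => ?_, fun v m => ?_⟩
    · rw [LinearMap.add_comp, LinearMap.comp_add, hf, hg]
    · simp [hf', hg']
  zero_mem' := ⟨fun a => by simp, fun v m => by simp⟩
  smul_mem' := by
    rintro c f ⟨hf, hf'⟩
    refine ⟨fun a => ?_, fun v m => ?_⟩
    · rw [LinearMap.smul_comp, LinearMap.comp_smul, hf]
    · simp [hf']

instance RightModRep.category : Category (RightModRep H M) where
  Hom V W := RightModRep.homs V W
  id V := ⟨LinearMap.id, fun _ => rfl, fun _ _ => rfl⟩
  comp f g := ⟨g.1 ∘ₗ f.1, fun a => by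
    rw [LinearMap.comp_assoc, f.2.1 a, ← LinearMap.comp_assoc, g.2.1 a, LinearMap.comp_assoc],
    fun v m => by rw [LinearMap.comp_apply, f.2.2, g.2.2, LinearMap.comp_apply]⟩

/-- The linear map underlying a morphism. -/
def RightModRep.toLin {V W : RightModRep H M} (f : V ⟶ W) : V.carrier →ₗ[ℂ] W.carrier :=
  Subtype.val f

theorem RightModRep.hom_ext {V W : RightModRep H M} {f g : V ⟶ W}
    (h : RightModRep.toLin f = RightModRep.toLin g) : f = g := Subtype.ext h

instance RightModRep.preadditive : Preadditive (RightModRep H M) where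
  homGroup V W := inferInstanceAs (AddCommGroup (RightModRep.homs V W))
  add_comp _ _ _ _ _ _ := Subtype.ext (LinearMap.comp_add _ _ _)
  comp_add _ _ _ _ _ _ := Subtype.ext (LinearMap.add_comp _ _ _)

instance RightModRep.linear : Linear ℂ (RightModRep H M) where
  homModule V W := inferInstanceAs (Module ℂ (RightModRep.homs V W))
  smul_comp _ _ _ _ _ _ := Subtype.ext (LinearMap.comp_smul _ _ _)
  comp_smul _ _ _ _ _ _ := Subtype.ext (LinearMap.smul_comp _ _ _)

/-- A morphism from a linear map that is both `H`-linear and `M`-linear. -/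
def RightModRep.mkHom {V W : RightModRep H M} (f : V.carrier →ₗ[ℂ] W.carrier)
    (hf : ∀ h, f ∘ₗ V.ρ h = W.ρ h ∘ₗ f) (hf' : ∀ v m, f (V.ract v m) = W.ract (f v) m) :
    V ⟶ W := ⟨f, hf, hf'⟩

/-- An isomorphism from a bijective linear map that is both `H`-linear and `M`-linear. -/
def RightModRep.mkIso {V W : RightModRep H M} (e : V.carrier ≃ₗ[ℂ] W.carrier)
    (he : ∀ h, e.toLinearMap ∘ₗ V.ρ h = W.ρ h ∘ₗ e.toLinearMap)
    (he' : ∀ v m, e (V.ract v m) = W.ract (e v) m) : V ≅ W where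
  hom := RightModRep.mkHom e.toLinearMap he he'
  inv := RightModRep.mkHom e.symm.toLinearMap (fun a => by
    ext w
    have := LinearMap.congr_fun (he a) (e.symm w)
    simp only [LinearMap.comp_apply, LinearEquiv.coe_coe, LinearEquiv.apply_symm_apply] at this ⊢
    rw [← this, LinearEquiv.symm_apply_apply]) (fun w m => by
    have := he' (e.symm w) m
    rw [LinearEquiv.apply_symm_apply] at this
    rw [LinearEquiv.coe_coe, ← this, LinearEquiv.symm_apply_apply])
  hom_inv_id := Subtype.ext (LinearMap.ext fun v => e.symm_apply_apply v)
  inv_hom_id := Subtype.ext (LinearMap.ext fun v => e.apply_symm_apply v)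

/-- The right action of `M` on `X ⊗ V` through the second factor. -/
def tensorRact (X : Type u) [AddCommGroup X] [Module ℂ X] {V : Type u} [AddCommGroup V]
    [Module ℂ V] (r : V →ₗ[ℂ] M →ₗ[ℂ] V) : X ⊗[ℂ] V →ₗ[ℂ] M →ₗ[ℂ] X ⊗[ℂ] V :=
  TensorProduct.curry (TensorProduct.map LinearMap.id (TensorProduct.lift r) ∘ₗ
    (TensorProduct.assoc ℂ X V M).toLinearMap)

/-- For a representation `X` of `H` and a right `M`-module `V` in `Rep(H)`, the right `M`-module
`X ⊗ V` in `Rep(H)`. -/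
def RightModRep.tensor (X : FDMod H) (V : RightModRep H M) : RightModRep H M where
  toFDMod := X ⊗ V.toFDMod
  ract := tensorRact X.carrier V.ract
  ract_one t := by
    induction t using TensorProduct.induction_on with
    | zero => simp
    | tmul x v => exact congrArg (x ⊗ₜ[ℂ] ·) (V.ract_one v)
    | add s t hs ht => simp only [map_add, LinearMap.add_apply, hs, ht]
  ract_mul t m m' := by
    induction t using TensorProduct.induction_on with
    | zero => simp
    | tmul x v => exact congrArg (x ⊗ₜ[ℂ] ·) (V.ract_mul v m m')
    | add s t hs ht => simp only [map_add, LinearMap.add_apply, hs, ht]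
  equivariant h := by
    have e1 := tensorRep_assoc (Bialgebra.comulAlgHom ℂ H) comul_coassoc' X.ρ V.ρ
      (ModuleAlgebra.act (M := M)) h
    have e2 := tensorRep_map (Bialgebra.comulAlgHom ℂ H) X.ρ
      (tensorRep (Bialgebra.comulAlgHom ℂ H) V.ρ (ModuleAlgebra.act (M := M))) X.ρ V.ρ
      LinearMap.id (TensorProduct.lift V.ract) (fun _ => rfl) (fun h => (V.equivariant h).symm) h
    have e3 : TensorProduct.lift (tensorRact X.carrier V.ract) =
        TensorProduct.map LinearMap.id (TensorProduct.lift V.ract) ∘ₗ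
          (TensorProduct.assoc ℂ X.carrier V.carrier M).toLinearMap :=
      TensorProduct.ext' fun _ _ => rfl
    change tensorRep _ X.ρ V.ρ h ∘ₗ TensorProduct.lift (tensorRact X.carrier V.ract) =
      TensorProduct.lift (tensorRact X.carrier V.ract) ∘ₗ
        tensorRep _ (tensorRep _ X.ρ V.ρ) ModuleAlgebra.act h
    rw [e3, LinearMap.comp_assoc, e1, ← LinearMap.comp_assoc, ← LinearMap.comp_assoc, e2]

theorem tensorRact_map {X X' V V' : Type u} [AddCommGroup X] [Module ℂ X] [AddCommGroup X']
    [Module ℂ X'] [AddCommGroup V] [Module ℂ V] [AddCommGroup V'] [Module ℂ V']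
    (r : V →ₗ[ℂ] M →ₗ[ℂ] V) (r' : V' →ₗ[ℂ] M →ₗ[ℂ] V') (f : X →ₗ[ℂ] X') (g : V →ₗ[ℂ] V')
    (hg : ∀ v m, g (r v m) = r' (g v) m) (t : X ⊗[ℂ] V) (m : M) :
    TensorProduct.map f g (tensorRact X r t m) =
      tensorRact X' r' (TensorProduct.map f g t) m := by
  induction t using TensorProduct.induction_on with
  | zero => simp
  | tmul x v => simp [tensorRact, hg]
  | add s t hs ht => simp only [map_add, LinearMap.add_apply, hs, ht]

theorem tensorRact_assoc {X Y V : Type u} [AddCommGroup X] [Module ℂ X] [AddCommGroup Y]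
    [Module ℂ Y] [AddCommGroup V] [Module ℂ V] (r : V →ₗ[ℂ] M →ₗ[ℂ] V)
    (t : (X ⊗[ℂ] Y) ⊗[ℂ] V) (m : M) :
    TensorProduct.assoc ℂ X Y V (tensorRact (X ⊗[ℂ] Y) r t m) =
      tensorRact X (tensorRact Y r) (TensorProduct.assoc ℂ X Y V t) m := by
  induction t using TensorProduct.induction_on with
  | zero => simp
  | add s t hs ht => simp only [map_add, LinearMap.add_apply, hs, ht]
  | tmul s v =>
    induction s using TensorProduct.induction_on with
    | zero => simp
    | tmul x y => simp [tensorRact]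
    | add s t hs ht => simp only [map_add, LinearMap.add_apply, TensorProduct.add_tmul, hs, ht]

theorem tensorRact_lid {V : Type u} [AddCommGroup V] [Module ℂ V] (r : V →ₗ[ℂ] M →ₗ[ℂ] V)
    (t : ULift.{u} ℂ ⊗[ℂ] V) (m : M) :
    lidEquiv V (tensorRact (ULift.{u} ℂ) r t m) = r (lidEquiv V t) m := by
  induction t using TensorProduct.induction_on with
  | zero => simp
  | tmul c v => simp [tensorRact, lidEquiv]
  | add s t hs ht => simp only [map_add, LinearMap.add_apply, hs, ht]

/-- The category of right `M`-modules in `Rep(H)` is a left `Rep(H)`-module category. -/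
instance moduleAlgebraActionStruct :
    MonoidalLeftActionStruct (FDMod H) (RightModRep H M) where
  actionObj X V := RightModRep.tensor X V
  actionHom f g := RightModRep.mkHom (TensorProduct.map (FDMod.toLin f) (RightModRep.toLin g))
    (tensorRep_map _ _ _ _ _ _ _ f.2 g.2.1) (tensorRact_map _ _ _ _ g.2.2)
  actionHomRight X _ _ g := RightModRep.mkHom (TensorProduct.map LinearMap.id (RightModRep.toLin g))
    (tensorRep_map _ _ _ _ _ _ _ (fun _ => rfl) g.2.1) (tensorRact_map _ _ _ _ g.2.2)
  actionHomLeft f V := RightModRep.mkHom (TensorProduct.map (FDMod.toLin f) LinearMap.id)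
    (tensorRep_map _ _ _ _ _ _ _ f.2 (fun _ => rfl)) (tensorRact_map _ _ _ _ (fun _ _ => rfl))
  actionAssocIso X Y V :=
    RightModRep.mkIso (TensorProduct.assoc ℂ X.carrier Y.carrier V.carrier)
      (tensorRep_assoc _ comul_coassoc' _ _ _) (tensorRact_assoc _)
  actionUnitIso V := RightModRep.mkIso (lidEquiv V.carrier)
    (tensorRep_lid _ (fun h => by
      rw [Bialgebra.comulAlgHom_apply, Coalgebra.rTensor_counit_comul]; simp) _)
    (tensorRact_lid _)

instance moduleAlgebraAction : MonoidalLeftAction (FDMod H) (RightModRep H M) where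
  actionHom_def _ _ := RightModRep.hom_ext (TensorProduct.ext' fun _ _ => rfl)
  actionHomRight_id _ _ := RightModRep.hom_ext TensorProduct.map_id
  id_actionHomLeft _ _ := RightModRep.hom_ext TensorProduct.map_id
  actionHom_comp _ _ _ _ := RightModRep.hom_ext (TensorProduct.map_comp _ _ _ _)
  actionAssocIso_hom_naturality _ _ _ :=
    RightModRep.hom_ext (TensorProduct.ext_threefold fun _ _ _ => rfl)
  actionUnitIso_hom_naturality f :=
    RightModRep.hom_ext (TensorProduct.ext' fun c x => (RightModRep.toLin f).map_smul c.down x)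
  whiskerLeft_actionHomLeft _ _ _ _ _ :=
    RightModRep.hom_ext (TensorProduct.ext_threefold fun _ _ _ => rfl)
  whiskerRight_actionHomLeft _ _ _ :=
    RightModRep.hom_ext (TensorProduct.ext_threefold fun _ _ _ => rfl)
  associator_actionHom _ _ _ _ :=
    RightModRep.hom_ext (TensorProduct.ext_fourfold fun _ _ _ _ => rfl)
  leftUnitor_actionHom _ _ :=
    RightModRep.hom_ext (TensorProduct.ext_threefold fun _ _ _ => rfl)
  rightUnitor_actionHom _ _ :=
    RightModRep.hom_ext (TensorProduct.ext_threefold fun x c y =>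
      TensorProduct.smul_tmul c.down x y)

variable (H M)

/-- An `M|N`-bimodule in `Rep(H)`: a finite-dimensional representation `P` of `H` that is an
`M|N`-bimodule whose actions `M ⊗ P → P` and `P ⊗ N → P` are `H`-linear. -/
structure BimoduleRep extends FDMod H where
  lact : M →ₗ[ℂ] carrier →ₗ[ℂ] carrier
  one_lact : ∀ p, lact 1 p = p
  mul_lact : ∀ m m' p, lact (m * m') p = lact m (lact m' p)
  ract : carrier →ₗ[ℂ] N →ₗ[ℂ] carrier
  ract_one : ∀ p, ract p 1 = p
  ract_mul : ∀ p n n', ract p (n * n') = ract (ract p n) n'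
  lact_ract : ∀ m p n, lact m (ract p n) = ract (lact m p) n
  lact_equivariant : ∀ h, ρ h ∘ₗ TensorProduct.lift lact =
    TensorProduct.lift lact ∘ₗ tensorRep (Bialgebra.comulAlgHom ℂ H) ModuleAlgebra.act ρ h
  ract_equivariant : ∀ h, ρ h ∘ₗ TensorProduct.lift ract =
    TensorProduct.lift ract ∘ₗ tensorRep (Bialgebra.comulAlgHom ℂ H) ρ ModuleAlgebra.act h

variable {H M N}

/-- `P ⊗_N Q ≅ M` as `M|M`-bimodules in `Rep(H)`. Here `H` acts on `P ⊗_N Q` by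
`h (p ⊗ q) = ∑ h₁ p ⊗ h₂ q`. -/
def BimoduleRep.TensorIsoRegular (P : BimoduleRep H M N) (Q : BimoduleRep H N M) : Prop :=
  ∃ e : BalancedTensor P.ract Q.lact ≃ₗ[ℂ] M,
    (∀ m p q, e (balancedMk P.ract Q.lact (P.lact m p) q) =
      m * e (balancedMk P.ract Q.lact p q)) ∧
    (∀ p q m, e (balancedMk P.ract Q.lact p (Q.ract q m)) =
      e (balancedMk P.ract Q.lact p q) * m) ∧
    (∀ h p q, ModuleAlgebra.act h (e (balancedMk P.ract Q.lact p q)) =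
      e ((balancedRelations P.ract Q.lact).mkQ
        (tensorRep (Bialgebra.comulAlgHom ℂ H) P.ρ Q.ρ h (p ⊗ₜ[ℂ] q))))

variable (H M N)

/-- Equivariant Morita equivalence of `H`-module algebras: there are bimodules `P` and `Q` in
`Rep(H)` with `P ⊗_N Q ≅ M` and `Q ⊗_M P ≅ N` as bimodules in `Rep(H)`. -/
def ModuleAlgebra.EquivariantlyMoritaEquivalent : Prop :=
  ∃ (P : BimoduleRep H M N) (Q : BimoduleRep H N M),
    P.TensorIsoRegular Q ∧ Q.TensorIsoRegular P

/-- The boundaries determined by two `H`-module algebras `M` and `N` are topologically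
equivalent: the `Rep(H)`-module categories of right `M`-modules and right `N`-modules in `Rep(H)`
are equivalent. -/
def ModuleAlgebra.TopologicallyEquivalent : Prop :=
  ModuleCatEquivalent (FDMod H) (RightModRep H M) (RightModRep H N)

end ModuleAlgebras

end HopfBoundary

end

/-! Both parts are equivariant versions of the Morita and Eilenberg–Watts theorems: module functors
correspond to equivariant bimodules, through tensoring in one direction and through the value on the
regular module in the other.

From bimodules to functors. In part (1) the functor is `V ↦ Q ⊗_A V`, with structure map `q ⊗ (x ⊗
v) ↦ ∑ q⁽⁻¹⁾ x ⊗ (q⁽⁰⁾ ⊗ v)`; in part (2) it is `V ↦ V ⊗_M P`, with the rebracketing `(X ⊗ V) ⊗_M P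
→ X ⊗ (V ⊗_M P)`. These maps visibly give oplax module functors. That they are invertible is not
shown by a formula: the isomorphisms `P ⊗_B Q ≅ A`, `Q ⊗_A P ≅ B` (likewise in part (2)) make the
two functors mutually inverse, compatibly with the oplax structures, and mutually inverse oplax
functors are automatically strong (`isIso_δₗ_of_comp`). In part (1), compatibility with the oplax
structures is precisely where colinearity of the bimodule isomorphism enters
(`CovariantBimodule.tensorδ_evalIso`).

From functors to bimodules. Let `F` be an equivalence of module categories. In part (1) `F(A)` is a
`B`-module on which `A` acts from the right by applying `F` to right multiplications. The coaction
of `A` is an `A`-linear map `A → H ⊗ A`, and `F(A) → F(H ⊗ A) → H ⊗ F(A)` is the coaction of `F(A)`.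
In part (2) the left action of `M` is `M ⊗ F(M) → F(M ⊗ M) → F(M)`. The canonical map `F(A) ⊗_A V →
F(V)`, or `V ⊗_M F(M) → F(V)`, is invertible (`isIso_evalFunctorHom`), because source and target are
the same quotient of `V ⊗ F(A)`, respectively `V ⊗ F(M)`. For the quasi-inverse `G`, which is again
a module functor, taking `V = F(A)` gives `G(B) ⊗_B F(A) ≅ G(F(A)) ≅ A`. The module structures of
`F` and `G` match under the unit and counit of the equivalence, which makes this an isomorphism of
equivariant bimodules (`tensorIsoRegular_ofFunctor`). -/

noncomputable section

namespace HopfBoundary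

/-! ### Module functors: invertibility of structure maps, and inverses of equivalences -/

section ModuleFunctors

open MonoidalLeftAction Functor LaxLeftLinear OplaxLeftLinear

variable {C D D' : Type*} [Category* C] [MonoidalCategory C] [Category* D] [Category* D']
  [MonoidalLeftAction C D] [MonoidalLeftAction C D']

/-- An oplax module functor whose structure morphisms are invertible is a strong module functor. -/
abbrev leftLinearOfOplax (F : D ⥤ D') [F.OplaxLeftLinear C]
    (h : ∀ (c : C) (d : D), IsIso (δₗ F c d)) : F.LeftLinear C where
  μₗ c d := inv (δₗ F c d)
  μₗ_naturality_left f d := by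
    rw [IsIso.eq_inv_comp, ← Category.assoc, IsIso.comp_inv_eq, δₗ_naturality_left]
  μₗ_naturality_right c _ _ f := by
    rw [IsIso.eq_inv_comp, ← Category.assoc, IsIso.comp_inv_eq, δₗ_naturality_right]
  μₗ_associativity c c' d := by
    -- Composing with the invertible `δₗ`'s on the right removes every `μₗ` and leaves the oplax
    -- associativity.
    rw [IsIso.inv_comp_eq, ← cancel_mono (δₗ F c (c' ⊙ₗ d) ≫ c ⊴ₗ δₗ F c' d)]
    simp [← actionHomRight_comp_assoc]
  μₗ_unitality d := by simp
  μₗ_comp_δₗ c d := by simp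
  δₗ_comp_μₗ c d := by simp

section Inverse

variable (e : D ≌ D')

/-- The components of the counit of an equivalence. -/
def counitComponent (d : D') : e.functor.obj (e.inverse.obj d) ≅ d := e.counitIso.app d

/-- The components of the inverse of the unit of an equivalence. -/
def unitComponent (d : D) : e.inverse.obj (e.functor.obj d) ≅ d := (e.unitIso.app d).symm

theorem counitComponent_naturality {d d' : D'} (f : d ⟶ d') :
    e.functor.map (e.inverse.map f) ≫ (counitComponent e d').hom =
      (counitComponent e d).hom ≫ f := e.counit.naturality f

theorem counitComponent_naturality_assoc {d d' d'' : D'} (f : d ⟶ d') (g : d' ⟶ d'') :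
    e.functor.map (e.inverse.map f) ≫ (counitComponent e d').hom ≫ g =
      (counitComponent e d).hom ≫ f ≫ g := by
  rw [← Category.assoc, counitComponent_naturality, Category.assoc]

theorem counitComponent_inv_naturality {d d' : D'} (f : d ⟶ d') :
    (counitComponent e d).inv ≫ e.functor.map (e.inverse.map f) =
      f ≫ (counitComponent e d').inv := (e.counitInv.naturality f).symm

theorem unitComponent_naturality {d d' : D} (f : d ⟶ d') :
    e.inverse.map (e.functor.map f) ≫ (unitComponent e d').hom =
      (unitComponent e d).hom ≫ f := e.unitInv.naturality f

theorem unitComponent_naturality_assoc {d d' d'' : D} (f : d ⟶ d') (g : d' ⟶ d'') :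
    e.inverse.map (e.functor.map f) ≫ (unitComponent e d').hom ≫ g =
      (unitComponent e d).hom ≫ f ≫ g := by
  rw [← Category.assoc, unitComponent_naturality, Category.assoc]

theorem functor_map_unitComponent_hom (d : D) :
    e.functor.map (unitComponent e d).hom = (counitComponent e (e.functor.obj d)).hom :=
  (e.counit_app_functor d).symm

theorem functor_map_unitComponent_inv (d : D) :
    e.functor.map (unitComponent e d).inv = (counitComponent e (e.functor.obj d)).inv :=
  (e.counitInv_app_functor d).symm

variable [e.functor.LeftLinear C]

/-- The structure morphism of the inverse of an equivalence of module categories. -/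
def inverseδ (c : C) (d : D') : e.inverse.obj (c ⊙ₗ d) ⟶ c ⊙ₗ e.inverse.obj d :=
  e.inverse.map (c ⊴ₗ (counitComponent e d).inv ≫ μₗ e.functor c (e.inverse.obj d)) ≫
    (unitComponent e _).hom

/-- The triangle identity removes the unit. Since `e.functor` is faithful, the axioms for the
inverse are checked after applying it, where only this expression occurs. -/
theorem functor_map_inverseδ (c : C) (d : D') :
    e.functor.map (inverseδ e c d) = (counitComponent e _).hom ≫
      c ⊴ₗ (counitComponent e d).inv ≫ μₗ e.functor c (e.inverse.obj d) := by
  rw [inverseδ, Functor.map_comp, functor_map_unitComponent_hom, counitComponent_naturality]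

instance isIso_inverseδ (c : C) (d : D') : IsIso (inverseδ e c d) := by
  unfold inverseδ; infer_instance

/-- The inverse of an equivalence of module categories is a module functor. -/
instance inverseOplaxLeftLinear : e.inverse.OplaxLeftLinear C where
  δₗ := inverseδ e
  δₗ_naturality_left f d := e.functor.map_injective (by
    simp only [Functor.map_comp, functor_map_inverseδ, Category.assoc, ← μₗ_naturality_left,
      action_exchange_assoc, counitComponent_naturality_assoc])
  δₗ_naturality_right c _ _ f := e.functor.map_injective (by
    simp only [Functor.map_comp, functor_map_inverseδ, Category.assoc, ← μₗ_naturality_right,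
      counitComponent_naturality_assoc]
    rw [← actionHomRight_comp_assoc, ← actionHomRight_comp_assoc, counitComponent_inv_naturality])
  δₗ_associativity c c' d := e.functor.map_injective (by
    simp only [Functor.map_comp, functor_map_inverseδ, Category.assoc, μₗ_associativity,
      ← μₗ_naturality_right, counitComponent_naturality_assoc]
    simp)
  δₗ_unitality_inv d := e.functor.map_injective (by
    simp only [Functor.map_comp, functor_map_inverseδ, counitComponent_naturality_assoc]
    simp)

instance inverseLeftLinear : e.inverse.LeftLinear C :=
  leftLinearOfOplax e.inverse (isIso_inverseδ e)

/-- The unit of the equivalence is a transformation of module functors. It is this compatibility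
that later makes `G(F(A)) ≅ A` respect coactions and `G(F(M)) ≅ M` respect left actions. -/
theorem map_μₗ_comp_unitComponent (c : C) (d : D) :
    e.inverse.map (μₗ e.functor c d) ≫ (unitComponent e (c ⊙ₗ d)).hom =
      δₗ e.inverse c (e.functor.obj d) ≫ c ⊴ₗ (unitComponent e d).hom := by
  change _ = inverseδ e c (e.functor.obj d) ≫ _
  rw [inverseδ, ← functor_map_unitComponent_inv, μₗ_naturality_right, Functor.map_comp,
    Category.assoc, Category.assoc, unitComponent_naturality_assoc, ← actionHomRight_comp]
  simp

theorem map_μₗ_comp_counitComponent (c : C) (d : D') :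
    e.functor.map (μₗ e.inverse c d) ≫ (counitComponent e (c ⊙ₗ d)).hom =
      δₗ e.functor c (e.inverse.obj d) ≫ c ⊴ₗ (counitComponent e d).hom := by
  have h : e.functor.map (δₗ e.inverse c d) = _ := functor_map_inverseδ e c d
  -- The `μₗ` of the inverse is only known as the inverse of its `δₗ`, so it is cancelled against
  -- the image of `δₗ`.
  rw [← cancel_epi (e.functor.map (δₗ e.inverse c d)), ← Functor.map_comp_assoc,
    LeftLinear.δₗ_comp_μₗ, h]
  simp [← actionHomRight_comp]

end Inverse

/-- By `hα` the composite of `G(δ_F)` and `δ_G` at `F d` is invertible, so this `δ_G` is split epi.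
By `hβ` at `F d`, its image under the faithful functor `F` is mono, so it is also mono. Hence it is
invertible, then so is `G(δ_F)`, and `G` reflects isomorphisms. -/
theorem isIso_δₗ_of_comp {F : D ⥤ D'} {G : D' ⥤ D} [F.OplaxLeftLinear C] [G.OplaxLeftLinear C]
    (α : F ⋙ G ≅ 𝟭 D) (β : G ⋙ F ≅ 𝟭 D')
    (hα : ∀ (c : C) d, G.map (δₗ F c d) ≫ δₗ G c (F.obj d) ≫ c ⊴ₗ α.hom.app d =
      α.hom.app (c ⊙ₗ d))
    (hβ : ∀ (c : C) d, F.map (δₗ G c d) ≫ δₗ F c (G.obj d) ≫ c ⊴ₗ β.hom.app d =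
      β.hom.app (c ⊙ₗ d)) (c : C) (d : D) : IsIso (δₗ F c d) := by
  have hF : F.IsEquivalence := (CategoryTheory.Equivalence.mk F G α.symm β).isEquivalence_functor
  have hG : G.IsEquivalence := (CategoryTheory.Equivalence.mk F G α.symm β).isEquivalence_inverse
  have : Mono (δₗ G c (F.obj d)) := by
    refine F.mono_of_mono_map ?_
    have : Mono (F.map (δₗ G c (F.obj d)) ≫
        δₗ F c (G.obj (F.obj d)) ≫ c ⊴ₗ β.hom.app (F.obj d)) := by rw [hβ]; infer_instance
    exact mono_of_mono _ (δₗ F c (G.obj (F.obj d)) ≫ c ⊴ₗ β.hom.app (F.obj d))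
  have h1 : IsIso (G.map (δₗ F c d) ≫ δₗ G c (F.obj d)) := by
    have := hα c d
    rw [← Category.assoc, ← IsIso.eq_comp_inv] at this
    rw [this]; infer_instance
  have : IsSplitEpi (δₗ G c (F.obj d)) :=
    ⟨⟨inv (G.map (δₗ F c d) ≫ δₗ G c (F.obj d)) ≫ G.map (δₗ F c d), by simp⟩⟩
  have : IsIso (δₗ G c (F.obj d)) := isIso_of_mono_of_isSplitEpi _
  have : IsIso (G.map (δₗ F c d)) := IsIso.of_isIso_comp_right _ (δₗ G c (F.obj d))
  exact isIso_of_reflects_iso _ G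

end ModuleFunctors

/-! ### Balanced tensor products -/

section BalancedTensor

variable {R P Q Z : Type u} [Ring R] [Algebra ℂ R] [AddCommGroup P] [Module ℂ P]
  [AddCommGroup Q] [Module ℂ Q] [AddCommGroup Z] [Module ℂ Z]
  {ract : P →ₗ[ℂ] R →ₗ[ℂ] P} {lact : R →ₗ[ℂ] Q →ₗ[ℂ] Q}

theorem balancedMk_ract (p : P) (r : R) (q : Q) :
    balancedMk ract lact (ract p r) q = balancedMk ract lact p (lact r q) :=
  (Submodule.Quotient.eq _).2 (Submodule.subset_span ⟨p, r, q, rfl⟩)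

/-- The linear map out of `P ⊗_R Q` determined by a balanced bilinear map. -/
def balancedLift (f : P →ₗ[ℂ] Q →ₗ[ℂ] Z) (hf : ∀ p r q, f (ract p r) q = f p (lact r q)) :
    BalancedTensor ract lact →ₗ[ℂ] Z :=
  (balancedRelations ract lact).liftQ (TensorProduct.lift f) (by
    refine Submodule.span_le.2 ?_
    rintro _ ⟨p, r, q, rfl⟩
    simp [hf])

@[simp]
theorem balancedLift_mk (f : P →ₗ[ℂ] Q →ₗ[ℂ] Z) (hf : ∀ p r q, f (ract p r) q = f p (lact r q))
    (p : P) (q : Q) : balancedLift f hf (balancedMk ract lact p q) = f p q := rfl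

theorem balanced_hom_ext {f g : BalancedTensor ract lact →ₗ[ℂ] Z}
    (h : ∀ p q, f (balancedMk ract lact p q) = g (balancedMk ract lact p q)) : f = g :=
  Submodule.linearMap_qext _ (TensorProduct.ext' h)

theorem balanced_induction {motive : BalancedTensor ract lact → Prop} (zero : motive 0)
    (add : ∀ s t, motive s → motive t → motive (s + t))
    (mk : ∀ p q, motive (balancedMk ract lact p q)) (t : BalancedTensor ract lact) : motive t := by
  obtain ⟨t, rfl⟩ := (balancedRelations ract lact).mkQ_surjective t
  induction t with
  | zero => simpa using zero
  | add s t hs ht => rw [map_add]; exact add _ _ hs ht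
  | tmul p q => exact mk p q

/-- A trilinear map balanced in its last two variables, as a bilinear map out of the balanced
tensor product. -/
def balancedLift₂ {W : Type u} [AddCommGroup W] [Module ℂ W] (f : W →ₗ[ℂ] P →ₗ[ℂ] Q →ₗ[ℂ] Z)
    (hf : ∀ w p r q, f w (ract p r) q = f w p (lact r q)) :
    W →ₗ[ℂ] BalancedTensor ract lact →ₗ[ℂ] Z where
  toFun w := balancedLift (f w) (hf w)
  map_add' w w' := balanced_hom_ext fun p q => by simp
  map_smul' c w := balanced_hom_ext fun p q => by simp

end BalancedTensor

/-- Puts the action on `X ⊗ M` in the same form `map₂` as the axioms of a covariant bimodule, so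
that Sweedler computations become statements about `map₂`. -/
theorem tensorRep_apply {H A X M : Type u} [Ring H] [Algebra ℂ H] [Ring A] [Algebra ℂ A]
    [AddCommGroup X] [Module ℂ X] [AddCommGroup M] [Module ℂ M]
    (β : A →ₐ[ℂ] H ⊗[ℂ] A) (ρX : H →ₐ[ℂ] Module.End ℂ X) (ρM : A →ₐ[ℂ] Module.End ℂ M) (a : A)
    (t : X ⊗[ℂ] M) :
    tensorRep β ρX ρM a t = TensorProduct.map₂ ρX.toLinearMap ρM.toLinearMap (β a) t := by
  simp only [tensorRep, AlgHom.comp_apply]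
  generalize β a = s
  induction s with
  | zero => simp
  | add s t hs ht => simp only [map_add, LinearMap.add_apply, hs, ht]
  | tmul h b => rfl

theorem FDMod.comp_apply {A : Type u} [Ring A] [Algebra ℂ A] {U V W : FDMod A} (f : U ⟶ V)
    (g : V ⟶ W) (x : U.carrier) : FDMod.toLin (f ≫ g) x = FDMod.toLin g (FDMod.toLin f x) := rfl

theorem FDMod.toLin_ρ {A : Type u} [Ring A] [Algebra ℂ A] {U V : FDMod A} (f : U ⟶ V)
    (a : A) (x : U.carrier) : FDMod.toLin f (U.ρ a x) = V.ρ a (FDMod.toLin f x) :=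
  LinearMap.congr_fun (f.2 a) x

theorem FDMod.congr_toLin {A : Type u} [Ring A] [Algebra ℂ A] {U V : FDMod A} {f g : U ⟶ V}
    (h : f = g) (x : U.carrier) : FDMod.toLin f x = FDMod.toLin g x := by rw [h]

/-! ### Sweedler calculus through `TensorProduct.map₂` -/

section Bilinear

variable {S₁ S₂ S₃ S₁₂ S₂₃ S T₁ T₂ T₃ T₁₂ T₂₃ T : Type*}
  [AddCommGroup S₁] [Module ℂ S₁] [AddCommGroup S₂] [Module ℂ S₂] [AddCommGroup S₃] [Module ℂ S₃]
  [AddCommGroup S₁₂] [Module ℂ S₁₂] [AddCommGroup S₂₃] [Module ℂ S₂₃] [AddCommGroup S] [Module ℂ S]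
  [AddCommGroup T₁] [Module ℂ T₁] [AddCommGroup T₂] [Module ℂ T₂] [AddCommGroup T₃] [Module ℂ T₃]
  [AddCommGroup T₁₂] [Module ℂ T₁₂] [AddCommGroup T₂₃] [Module ℂ T₂₃] [AddCommGroup T] [Module ℂ T]

/-- A mixed associativity law that holds in each leg holds for the leg-wise operation. With the
`H`-leg in the first factor, this covers associativity, compatibility with actions, and balancing,
for elements that are sums of pure tensors. -/
theorem map₂_map₂ (f : S₁ →ₗ[ℂ] S₂ →ₗ[ℂ] S₁₂) (g : T₁ →ₗ[ℂ] T₂ →ₗ[ℂ] T₁₂)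
    (f' : S₁₂ →ₗ[ℂ] S₃ →ₗ[ℂ] S) (g' : T₁₂ →ₗ[ℂ] T₃ →ₗ[ℂ] T)
    (k : S₂ →ₗ[ℂ] S₃ →ₗ[ℂ] S₂₃) (l : T₂ →ₗ[ℂ] T₃ →ₗ[ℂ] T₂₃)
    (k' : S₁ →ₗ[ℂ] S₂₃ →ₗ[ℂ] S) (l' : T₁ →ₗ[ℂ] T₂₃ →ₗ[ℂ] T)
    (hf : ∀ a b c, f' (f a b) c = k' a (k b c)) (hg : ∀ a b c, g' (g a b) c = l' a (l b c))
    (s : S₁ ⊗[ℂ] T₁) (u : S₂ ⊗[ℂ] T₂) (t : S₃ ⊗[ℂ] T₃) :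
    TensorProduct.map₂ f' g' (TensorProduct.map₂ f g s u) t =
      TensorProduct.map₂ k' l' s (TensorProduct.map₂ k l u t) := by
  induction s with
  | zero => simp
  | add s s' hs hs' => simp only [map_add, LinearMap.add_apply, hs, hs']
  | tmul a a' =>
    induction u with
    | zero => simp
    | add u u' hu hu' => simp only [map_add, LinearMap.add_apply, hu, hu']
    | tmul b b' =>
      induction t with
      | zero => simp
      | add t t' ht ht' => simp only [map_add, ht, ht']
      | tmul c c' => simp [hf, hg]

theorem map_map₂ (f : S₁ →ₗ[ℂ] S₂ →ₗ[ℂ] S₁₂) (g : T₁ →ₗ[ℂ] T₂ →ₗ[ℂ] T₁₂)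
    (f' : S₃ →ₗ[ℂ] S₂₃ →ₗ[ℂ] S) (g' : T₃ →ₗ[ℂ] T₂₃ →ₗ[ℂ] T)
    (a : S₁ →ₗ[ℂ] S₃) (a' : T₁ →ₗ[ℂ] T₃) (b : S₂ →ₗ[ℂ] S₂₃) (b' : T₂ →ₗ[ℂ] T₂₃)
    (c : S₁₂ →ₗ[ℂ] S) (c' : T₁₂ →ₗ[ℂ] T)
    (hf : ∀ x y, c (f x y) = f' (a x) (b y)) (hg : ∀ x y, c' (g x y) = g' (a' x) (b' y))
    (s : S₁ ⊗[ℂ] T₁) (t : S₂ ⊗[ℂ] T₂) :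
    TensorProduct.map c c' (TensorProduct.map₂ f g s t) =
      TensorProduct.map₂ f' g' (TensorProduct.map a a' s) (TensorProduct.map b b' t) := by
  induction s with
  | zero => simp
  | add s s' hs hs' => simp only [map_add, LinearMap.add_apply, hs, hs']
  | tmul h q =>
    induction t with
    | zero => simp
    | add t t' ht ht' => simp only [map_add, ht, ht']
    | tmul x v => simp [hf, hg]

theorem map_map₂_left (f : S₁ →ₗ[ℂ] S₂ →ₗ[ℂ] S₁₂) (g : T₁ →ₗ[ℂ] T₂ →ₗ[ℂ] T₁₂)
    (f' : S₁ →ₗ[ℂ] S₂ →ₗ[ℂ] S) (g' : T₁ →ₗ[ℂ] T₂ →ₗ[ℂ] T) (c : S₁₂ →ₗ[ℂ] S) (c' : T₁₂ →ₗ[ℂ] T)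
    (hf : ∀ x y, c (f x y) = f' x y) (hg : ∀ x y, c' (g x y) = g' x y)
    (s : S₁ ⊗[ℂ] T₁) (t : S₂ ⊗[ℂ] T₂) :
    TensorProduct.map c c' (TensorProduct.map₂ f g s t) = TensorProduct.map₂ f' g' s t := by
  simpa using map_map₂ f g f' g' LinearMap.id LinearMap.id LinearMap.id LinearMap.id c c' hf hg s t

theorem map₂_map_left (f : S₁₂ →ₗ[ℂ] S₂ →ₗ[ℂ] S) (g : T₁₂ →ₗ[ℂ] T₂ →ₗ[ℂ] T)
    (f' : S₁ →ₗ[ℂ] S₂ →ₗ[ℂ] S) (g' : T₁ →ₗ[ℂ] T₂ →ₗ[ℂ] T) (c : S₁ →ₗ[ℂ] S₁₂) (c' : T₁ →ₗ[ℂ] T₁₂)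
    (hf : ∀ x y, f (c x) y = f' x y) (hg : ∀ x y, g (c' x) y = g' x y)
    (s : S₁ ⊗[ℂ] T₁) (t : S₂ ⊗[ℂ] T₂) :
    TensorProduct.map₂ f g (TensorProduct.map c c' s) t = TensorProduct.map₂ f' g' s t := by
  simpa using (map_map₂ f' g' f g c c' LinearMap.id LinearMap.id LinearMap.id LinearMap.id
    (fun x y => (hf x y).symm) (fun x y => (hg x y).symm) s t).symm

variable {H X Y : Type u} [Ring H] [Bialgebra ℂ H] [AddCommGroup X] [Module ℂ X]
  [AddCommGroup Y] [Module ℂ Y]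

/-- Acting on `X ⊗ Y` means comultiplying the `H`-leg first. Combined with coassociativity of a
coaction, this gives the associativity axiom for the structure map built from that coaction;
`lidEquiv_map₂_trivRep` plays the same role for the unit axiom. -/
theorem assoc_map₂_tensorRep (ρX : H →ₐ[ℂ] Module.End ℂ X) (ρY : H →ₐ[ℂ] Module.End ℂ Y)
    (g : S₁ →ₗ[ℂ] S₂ →ₗ[ℂ] S) (s : H ⊗[ℂ] S₁) (t : (X ⊗[ℂ] Y) ⊗[ℂ] S₂) :
    TensorProduct.assoc ℂ X Y S (TensorProduct.map₂
        (tensorRep (Bialgebra.comulAlgHom ℂ H) ρX ρY).toLinearMap g s t) =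
      TensorProduct.map₂ ρX.toLinearMap (TensorProduct.map₂ ρY.toLinearMap g)
        (TensorProduct.assoc ℂ H H S₁ (Coalgebra.comul.rTensor S₁ s))
        (TensorProduct.assoc ℂ X Y S₂ t) := by
  induction s with
  | zero => simp
  | add s s' hs hs' => simp only [map_add, LinearMap.add_apply, hs, hs']
  | tmul h q =>
    induction t with
    | zero => simp
    | add t t' ht ht' => simp only [map_add, ht, ht']
    | tmul w v =>
      simp only [TensorProduct.map₂_apply_tmul, AlgHom.toLinearMap_apply, LinearMap.rTensor_tmul,
        TensorProduct.map_tmul, tensorRep_apply, Bialgebra.comulAlgHom_apply]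
      generalize (Coalgebra.comul h : H ⊗[ℂ] H) = z
      induction z with
      | zero => simp
      | add z z' hz hz' =>
        simp only [map_add, LinearMap.add_apply, TensorProduct.add_tmul, hz, hz']
      | tmul h h' =>
        induction w with
        | zero => simp
        | add z z' hz hz' =>
          simp only [map_add, TensorProduct.add_tmul, hz, hz']
        | tmul x y => simp

theorem lidEquiv_map₂_trivRep {V W : Type u} [AddCommGroup V] [Module ℂ V] [AddCommGroup W]
    [Module ℂ W] (g : S₁ →ₗ[ℂ] V →ₗ[ℂ] W) (s : H ⊗[ℂ] S₁) (t : ULift.{u} ℂ ⊗[ℂ] V) :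
    lidEquiv W (TensorProduct.map₂ (trivRep H).toLinearMap g s t) =
      g (TensorProduct.lid ℂ S₁ (Coalgebra.counit.rTensor S₁ s)) (lidEquiv V t) := by
  induction s with
  | zero => simp
  | add s s' hs hs' => simp only [map_add, LinearMap.add_apply, hs, hs']
  | tmul h q =>
    induction t with
    | zero => simp
    | add t t' ht ht' => simp only [map_add, ht, ht']
    | tmul c v => simp [lidEquiv, trivRep, Algebra.ofId_apply, smul_smul, mul_comm]

end Bilinear

/-- The oplax unit axiom is stated with inverse unitors; the unitors themselves have an explicit
formula on elements, so the axiom is verified in that form. -/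
theorem unitality_inv_of_hom {C D D' : Type*} [Category* C] [MonoidalCategory C] [Category* D]
    [Category* D'] [MonoidalLeftAction C D] [MonoidalLeftAction C D'] (F : D ⥤ D') {d : D}
    (δ : F.obj (MonoidalLeftAction.actionObj (𝟙_ C) d) ⟶
      MonoidalLeftAction.actionObj (𝟙_ C) (F.obj d))
    (h : δ ≫ (MonoidalLeftAction.actionUnitIso (F.obj d)).hom =
      F.map (MonoidalLeftAction.actionUnitIso (C := C) d).hom) :
    (MonoidalLeftAction.actionUnitIso (C := C) (F.obj d)).inv =
      F.map (MonoidalLeftAction.actionUnitIso (C := C) d).inv ≫ δ := by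
  rw [← cancel_mono (MonoidalLeftAction.actionUnitIso (C := C) (F.obj d)).hom, Iso.inv_hom_id,
    Category.assoc, h, ← CategoryTheory.Functor.map_comp, Iso.inv_hom_id,
    CategoryTheory.Functor.map_id]

/-! ### Part (1): the oplax module functor attached to a covariant bimodule -/

section CovariantTensor

open MonoidalLeftAction

variable {H A B : Type u} [Ring H] [Bialgebra ℂ H]
  [Ring A] [Algebra ℂ A] [ComoduleAlgebra H A] [Ring B] [Algebra ℂ B] [ComoduleAlgebra H B]

namespace CovariantBimodule

/-- The left `B`-module `Q ⊗_A V`. -/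
def tensor (Q : CovariantBimodule H B A) (V : FDMod A) : FDMod B where
  carrier := BalancedTensor Q.ract V.ρ.toLinearMap
  ρ := AlgHom.ofLinearMap
    { toFun b := balancedLift ((balancedMk Q.ract V.ρ.toLinearMap) ∘ₗ Q.lact b) fun p r q => by
        simp only [LinearMap.comp_apply, Q.lact_ract, balancedMk_ract]
      map_add' b b' := balanced_hom_ext fun p q => by simp
      map_smul' c b := balanced_hom_ext fun p q => by simp }
    (balanced_hom_ext fun p q => by simp [Q.one_lact])
    (fun b b' => balanced_hom_ext fun p q => by simp [Q.mul_lact])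

/-- The functor `V ↦ Q ⊗_A V`. -/
def tensorFunctor (Q : CovariantBimodule H B A) : FDMod A ⥤ FDMod B where
  obj := Q.tensor
  map {_ W} f := FDMod.mkHom
    (balancedLift ((balancedMk Q.ract W.ρ.toLinearMap).compl₂ (FDMod.toLin f)) fun p r q =>
      (balancedMk_ract p r (FDMod.toLin f q)).trans
        (congrArg (balancedMk Q.ract W.ρ.toLinearMap p) (FDMod.toLin_ρ f r q).symm))
    (fun _ => balanced_hom_ext fun _ _ => rfl)
  map_id _ := FDMod.hom_ext (balanced_hom_ext fun _ _ => rfl)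
  map_comp _ _ := FDMod.hom_ext (balanced_hom_ext fun _ _ => rfl)

instance (Q : CovariantBimodule H B A) : Q.tensorFunctor.Additive where
  map_add {_ W f g} := FDMod.hom_ext (balanced_hom_ext fun p q =>
    ((balancedMk Q.ract W.ρ.toLinearMap) p).map_add (FDMod.toLin f q) (FDMod.toLin g q))

instance (Q : CovariantBimodule H B A) : Q.tensorFunctor.Linear ℂ where
  map_smul {_ W} f c := FDMod.hom_ext (balanced_hom_ext fun p q =>
    ((balancedMk Q.ract W.ρ.toLinearMap) p).map_smul c (FDMod.toLin f q))

/-- The bilinear map `(h ⊗ q, x ⊗ v) ↦ h x ⊗ (q ⊗_A v)`. -/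
abbrev spread (Q : CovariantBimodule H B A) (X : FDMod H) (V : FDMod A) :
    H ⊗[ℂ] Q.carrier →ₗ[ℂ] X.carrier ⊗[ℂ] V.carrier →ₗ[ℂ]
      X.carrier ⊗[ℂ] BalancedTensor Q.ract V.ρ.toLinearMap :=
  TensorProduct.map₂ X.ρ.toLinearMap (balancedMk Q.ract V.ρ.toLinearMap)

/-- Covariance on the right, together with `q a ⊗ v = q ⊗ a v` in the second leg: this is what lets
the structure map descend to `Q ⊗_A (X ⊗ V)`. Covariance on the left, in `spread_δ_lact`, makes it
`B`-linear. -/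
theorem spread_δ_ract (Q : CovariantBimodule H B A) (X : FDMod H) (V : FDMod A)
    (q : Q.carrier) (a : A) (t : X.carrier ⊗[ℂ] V.carrier) :
    Q.spread X V (Q.δ (Q.ract q a)) t =
      Q.spread X V (Q.δ q) (tensorRep ComoduleAlgebra.coaction X.ρ V.ρ a t) := by
  rw [Q.δ_ract, tensorRep_apply]
  exact map₂_map₂ _ _ _ _ _ _ _ _ (fun h h' x => by simp) (fun p a v => balancedMk_ract p a v)
    _ _ _

theorem spread_δ_lact (Q : CovariantBimodule H B A) (X : FDMod H) (V : FDMod A)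
    (b : B) (q : Q.carrier) (t : X.carrier ⊗[ℂ] V.carrier) :
    Q.spread X V (Q.δ (Q.lact b q)) t =
      tensorRep ComoduleAlgebra.coaction X.ρ (Q.tensor V).ρ b (Q.spread X V (Q.δ q) t) := by
  rw [Q.δ_lact]
  refine Eq.trans ?_ (tensorRep_apply _ _ _ b _).symm
  exact map₂_map₂ _ _ _ _ _ _ _ _ (fun h h' x => by simp) (fun b q v => rfl) _ _ _

/-- The morphism `Q ⊗_A (X ⊗ V) ⟶ X ⊗ (Q ⊗_A V)`, `q ⊗ (x ⊗ v) ↦ ∑ q⁽⁻¹⁾ x ⊗ (q⁽⁰⁾ ⊗ v)`. -/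
def tensorδ (Q : CovariantBimodule H B A) (X : FDMod H) (V : FDMod A) :
    Q.tensorFunctor.obj (X ⊙ₗ V) ⟶ X ⊙ₗ Q.tensorFunctor.obj V :=
  FDMod.mkHom (balancedLift (Q.spread X V ∘ₗ Q.δ) (Q.spread_δ_ract X V))
    (fun b => balanced_hom_ext fun q t => Q.spread_δ_lact X V b q t)

theorem spread_map (Q : CovariantBimodule H B A) {X X' : FDMod H} {V V' : FDMod A} (f : X ⟶ X')
    (g : V ⟶ V') (s : H ⊗[ℂ] Q.carrier) (t : X.carrier ⊗[ℂ] V.carrier) :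
    TensorProduct.map (FDMod.toLin f) (FDMod.toLin (Q.tensorFunctor.map g))
        (Q.spread X V s t) =
      Q.spread X' V' s (TensorProduct.map (FDMod.toLin f) (FDMod.toLin g) t) := by
  have := map_map₂ X.ρ.toLinearMap (balancedMk Q.ract V.ρ.toLinearMap)
    X'.ρ.toLinearMap (balancedMk Q.ract V'.ρ.toLinearMap) LinearMap.id LinearMap.id
    (FDMod.toLin f) (FDMod.toLin g) (FDMod.toLin f) (FDMod.toLin (Q.tensorFunctor.map g))
    (fun h x => FDMod.toLin_ρ f h x) (fun q v => rfl) s t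
  rwa [TensorProduct.map_id] at this

/-- Moving `Q` past `X` and then past `Y` applies the coaction a second time to the `Q`-leg. This is
one side of the associativity axiom; the other side comultiplies the `H`-leg, and coassociativity of
`Q` equates them. -/
theorem map_tensorδ_spread (Q : CovariantBimodule H B A) (X Y : FDMod H) (V : FDMod A)
    (s : H ⊗[ℂ] Q.carrier) (t : X.carrier ⊗[ℂ] (Y.carrier ⊗[ℂ] V.carrier)) :
    TensorProduct.map LinearMap.id (FDMod.toLin (Q.tensorδ Y V))
      (Q.spread X (Y ⊙ₗ V) s t) =
      TensorProduct.map₂ X.ρ.toLinearMap (Q.spread Y V) (Q.δ.lTensor H s) t := by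
  refine (map_map₂_left X.ρ.toLinearMap (balancedMk Q.ract (Y ⊙ₗ V).ρ.toLinearMap)
    X.ρ.toLinearMap (Q.spread Y V ∘ₗ Q.δ) LinearMap.id (FDMod.toLin (Q.tensorδ Y V))
    (fun h x => rfl) (fun q v => rfl) s t).trans ?_
  exact (map₂_map_left X.ρ.toLinearMap (Q.spread Y V) X.ρ.toLinearMap (Q.spread Y V ∘ₗ Q.δ)
    LinearMap.id Q.δ (fun h x => rfl) (fun q v => rfl) s t).symm

instance tensorOplaxLeftLinear (Q : CovariantBimodule H B A) :
    Q.tensorFunctor.OplaxLeftLinear (FDMod H) where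
  δₗ X V := Q.tensorδ X V
  δₗ_naturality_left f V := FDMod.hom_ext (balanced_hom_ext fun q t => by
    have := Q.spread_map f (𝟙 V) (Q.δ q) t
    rw [Q.tensorFunctor.map_id] at this
    exact this.symm)
  δₗ_naturality_right X _ _ g := FDMod.hom_ext (balanced_hom_ext fun q t =>
    (Q.spread_map (𝟙 X) g (Q.δ q) t).symm)
  δₗ_associativity X Y V := FDMod.hom_ext (balanced_hom_ext fun q t => by
    have h1 := assoc_map₂_tensorRep X.ρ Y.ρ (balancedMk Q.ract V.ρ.toLinearMap) (Q.δ q) t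
    rw [Q.coassoc] at h1
    exact h1.trans (Q.map_tensorδ_spread X Y V (Q.δ q)
      (TensorProduct.assoc ℂ X.carrier Y.carrier V.carrier t)).symm)
  δₗ_unitality_inv V := unitality_inv_of_hom Q.tensorFunctor (Q.tensorδ (𝟙_ (FDMod H)) V)
    (FDMod.hom_ext (balanced_hom_ext fun q t => by
      have h1 := lidEquiv_map₂_trivRep (balancedMk Q.ract V.ρ.toLinearMap) (Q.δ q) t
      rw [Q.counit] at h1
      exact h1))

end CovariantBimodule

end CovariantTensor

/-! ### Part (1): equivariant Morita equivalence implies equivalence of module categories -/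

section CovariantMorita

open MonoidalLeftAction

variable {H A B : Type u} [Ring H] [Bialgebra ℂ H]
  [Ring A] [Algebra ℂ A] [ComoduleAlgebra H A] [Ring B] [Algebra ℂ B] [ComoduleAlgebra H B]

namespace CovariantBimodule

variable (P : CovariantBimodule H A B) (Q : CovariantBimodule H B A)
  (e : BalancedTensor P.ract Q.lact ≃ₗ[ℂ] A) (V : FDMod A)

/-- The bilinear map `(p, q ⊗ v) ↦ e(p ⊗ q) v`. -/
def evalBilin (hr : ∀ p q a, e (balancedMk P.ract Q.lact p (Q.ract q a)) =
      e (balancedMk P.ract Q.lact p q) * a) :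
    P.carrier →ₗ[ℂ] BalancedTensor Q.ract V.ρ.toLinearMap →ₗ[ℂ] V.carrier :=
  balancedLift₂ ((balancedMk P.ract Q.lact).compr₂ (V.ρ.toLinearMap ∘ₗ e.toLinearMap))
    fun p q a v => by simp [hr]

/-- The bilinear map `(p ⊗ q, v) ↦ p ⊗ (q ⊗ v)`. -/
def assocBilin :
    BalancedTensor P.ract Q.lact →ₗ[ℂ] V.carrier →ₗ[ℂ]
      BalancedTensor P.ract (Q.tensor V).ρ.toLinearMap :=
  balancedLift
    { toFun p := (balancedMk Q.ract V.ρ.toLinearMap).compr₂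
        (balancedMk P.ract (Q.tensor V).ρ.toLinearMap p)
      map_add' p p' := LinearMap.ext₂ fun q v =>
        LinearMap.congr_fun (map_add (balancedMk P.ract (Q.tensor V).ρ.toLinearMap) p p')
          (balancedMk Q.ract V.ρ.toLinearMap q v)
      map_smul' c p := LinearMap.ext₂ fun q v =>
        LinearMap.congr_fun (map_smul (balancedMk P.ract (Q.tensor V).ρ.toLinearMap) c p)
          (balancedMk Q.ract V.ρ.toLinearMap q v) }
    fun p b q => LinearMap.ext fun v =>
      balancedMk_ract (lact := (Q.tensor V).ρ.toLinearMap) p b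
        (balancedMk Q.ract V.ρ.toLinearMap q v)

variable {P Q e V}

theorem assocBilin_mk (p : P.carrier) (q : Q.carrier) (v : V.carrier) :
    assocBilin P Q V (balancedMk P.ract Q.lact p q) v =
      balancedMk P.ract (Q.tensor V).ρ.toLinearMap p (balancedMk Q.ract V.ρ.toLinearMap q v) :=
  rfl

/-- Right `A`-linearity of `e`, read for `e.symm`, with `a` moved across the inner tensor sign over
`A`. -/
theorem assocBilin_symm (hr : ∀ p q a, e (balancedMk P.ract Q.lact p (Q.ract q a)) =
      e (balancedMk P.ract Q.lact p q) * a) (x a : A) (v : V.carrier) :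
    assocBilin P Q V (e.symm x) (V.ρ a v) = assocBilin P Q V (e.symm (x * a)) v := by
  obtain ⟨t, rfl⟩ := e.surjective x
  rw [e.symm_apply_apply]
  induction t using balanced_induction with
  | zero => simp
  | add s t hs ht => simp only [map_add, LinearMap.add_apply, hs, ht, add_mul]
  | mk p q =>
    rw [← hr, e.symm_apply_apply, assocBilin_mk, assocBilin_mk]
    exact congrArg (balancedMk P.ract (Q.tensor V).ρ.toLinearMap p)
      (balancedMk_ract q a v).symm

theorem evalBilin_ract (hr : ∀ p q a, e (balancedMk P.ract Q.lact p (Q.ract q a)) =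
      e (balancedMk P.ract Q.lact p q) * a) (p : P.carrier) (b : B)
    (t : BalancedTensor Q.ract V.ρ.toLinearMap) :
    evalBilin P Q e V hr (P.ract p b) t = evalBilin P Q e V hr p ((Q.tensor V).ρ b t) :=
  LinearMap.congr_fun (g := evalBilin P Q e V hr p ∘ₗ (Q.tensor V).ρ b)
    (balanced_hom_ext fun q v => congrArg (fun z => V.ρ (e z) v) (balancedMk_ract p b q)) t

theorem evalBilin_lact (hl : ∀ a p q, e (balancedMk P.ract Q.lact (P.lact a p) q) =
      a * e (balancedMk P.ract Q.lact p q))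
    (hr : ∀ p q a, e (balancedMk P.ract Q.lact p (Q.ract q a)) =
      e (balancedMk P.ract Q.lact p q) * a) (a : A) (p : P.carrier)
    (t : BalancedTensor Q.ract V.ρ.toLinearMap) :
    evalBilin P Q e V hr (P.lact a p) t = V.ρ a (evalBilin P Q e V hr p t) :=
  LinearMap.congr_fun (g := V.ρ a ∘ₗ evalBilin P Q e V hr p)
    (balanced_hom_ext fun q v => by
      change V.ρ (e (balancedMk P.ract Q.lact (P.lact a p) q)) v =
        V.ρ a (V.ρ (e (balancedMk P.ract Q.lact p q)) v)
      rw [hl, map_mul]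
      rfl) t

/-- The map `P ⊗_B (Q ⊗_A V) → V`, `p ⊗ (q ⊗ v) ↦ e(p ⊗ q) v`. -/
def evalMap (hr : ∀ p q a, e (balancedMk P.ract Q.lact p (Q.ract q a)) =
      e (balancedMk P.ract Q.lact p q) * a) :
    BalancedTensor P.ract (Q.tensor V).ρ.toLinearMap →ₗ[ℂ] V.carrier :=
  balancedLift (lact := (Q.tensor V).ρ.toLinearMap) (evalBilin P Q e V hr) (evalBilin_ract hr)

theorem evalMap_assocBilin (hr : ∀ p q a, e (balancedMk P.ract Q.lact p (Q.ract q a)) =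
      e (balancedMk P.ract Q.lact p q) * a) (t : BalancedTensor P.ract Q.lact) (v : V.carrier) :
    evalMap hr (assocBilin P Q V t v) = V.ρ (e t) v := by
  induction t using balanced_induction with
  | zero => simp
  | add s t hs ht => simp only [map_add, LinearMap.add_apply, hs, ht]
  | mk p q => rfl

/-- The isomorphism `P ⊗_B (Q ⊗_A V) ≅ V`, `p ⊗ (q ⊗ v) ↦ e(p ⊗ q) v`. -/
def evalEquiv (hr : ∀ p q a, e (balancedMk P.ract Q.lact p (Q.ract q a)) =
      e (balancedMk P.ract Q.lact p q) * a) :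
    BalancedTensor P.ract (Q.tensor V).ρ.toLinearMap ≃ₗ[ℂ] V.carrier :=
  LinearEquiv.ofLinearMap (evalMap hr) (assocBilin P Q V (e.symm 1))
    (LinearMap.ext fun v => by simpa using evalMap_assocBilin hr (e.symm 1) v)
    (balanced_hom_ext fun p t => by
      refine LinearMap.congr_fun (f := assocBilin P Q V (e.symm 1) ∘ₗ evalBilin P Q e V hr p)
        (g := balancedMk P.ract (Q.tensor V).ρ.toLinearMap p) (balanced_hom_ext fun q v => ?_) t
      -- The proposed inverse is `v ↦ e⁻¹(1) ⊗ v`; applied to `e(p ⊗ q) v`, the scalar is absorbed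
      -- and `e⁻¹(e(p ⊗ q)) ⊗ v = p ⊗ (q ⊗ v)` remains.
      have h := assocBilin_symm hr 1 (e (balancedMk P.ract Q.lact p q)) v
      rw [one_mul, e.symm_apply_apply] at h
      exact h)

/-- The natural isomorphism `P ⊗_B (Q ⊗_A V) ≅ V` induced by `P ⊗_B Q ≅ A`. -/
def evalIso (hl : ∀ a p q, e (balancedMk P.ract Q.lact (P.lact a p) q) =
      a * e (balancedMk P.ract Q.lact p q))
    (hr : ∀ p q a, e (balancedMk P.ract Q.lact p (Q.ract q a)) =
      e (balancedMk P.ract Q.lact p q) * a) :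
    Q.tensorFunctor ⋙ P.tensorFunctor ≅ 𝟭 (FDMod A) :=
  NatIso.ofComponents
    (fun V => FDMod.mkIso (V := P.tensor (Q.tensor V)) (W := V) (evalEquiv hr) fun a =>
      balanced_hom_ext fun p t => evalBilin_lact hl hr a p t)
    (fun {V W} f => FDMod.hom_ext (balanced_hom_ext fun p t => by
      refine LinearMap.congr_fun
        (f := evalBilin P Q e W hr p ∘ₗ FDMod.toLin (Q.tensorFunctor.map f))
        (g := FDMod.toLin f ∘ₗ evalBilin P Q e V hr p) (balanced_hom_ext fun q v => ?_) t
      exact (FDMod.toLin_ρ f _ v).symm))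

/-- On `p ⊗ (q ⊗ (x ⊗ v))` the left side is `∑ p⁽⁻¹⁾ q⁽⁻¹⁾ x ⊗ e(p⁽⁰⁾ ⊗ q⁽⁰⁾) v`. By colinearity of
`e` this is the action of `e(p ⊗ q)` on `x ⊗ v`, which is the right side. -/
theorem tensorδ_evalIso (hl : ∀ a p q, e (balancedMk P.ract Q.lact (P.lact a p) q) =
      a * e (balancedMk P.ract Q.lact p q))
    (hr : ∀ p q a, e (balancedMk P.ract Q.lact p (Q.ract q a)) =
      e (balancedMk P.ract Q.lact p q) * a)
    (hc : ∀ p q, ComoduleAlgebra.coaction (e (balancedMk P.ract Q.lact p q)) =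
      e.toLinearMap.lTensor H (TensorProduct.map₂ (LinearMap.mul ℂ H)
        (balancedMk P.ract Q.lact) (P.δ p) (Q.δ q))) (X : FDMod H) (V : FDMod A) :
    P.tensorFunctor.map (Q.tensorδ X V) ≫ P.tensorδ X (Q.tensorFunctor.obj V) ≫
        X ⊴ₗ (evalIso hl hr).hom.app V =
      (evalIso hl hr).hom.app (X ⊙ₗ V) := by
  refine FDMod.hom_ext (balanced_hom_ext fun p t => ?_)
  refine LinearMap.congr_fun
    (f := FDMod.toLin (P.tensorδ X (Q.tensorFunctor.obj V) ≫ X ⊴ₗ (evalIso hl hr).hom.app V) ∘ₗ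
      balancedMk P.ract _ p ∘ₗ FDMod.toLin (Q.tensorδ X V))
    (g := evalBilin P Q e (X ⊙ₗ V) hr p) (balanced_hom_ext fun q z => ?_) t
  refine (map_map₂_left X.ρ.toLinearMap (balancedMk P.ract (Q.tensor V).ρ.toLinearMap)
    X.ρ.toLinearMap (evalBilin P Q e V hr) LinearMap.id (evalMap hr) (fun _ _ => rfl)
    (fun _ _ => rfl) (P.δ p) (Q.spread X V (Q.δ q) z)).trans ?_
  refine (map₂_map₂ (LinearMap.mul ℂ H) (balancedMk P.ract Q.lact) X.ρ.toLinearMap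
    (V.ρ.toLinearMap ∘ₗ e.toLinearMap) X.ρ.toLinearMap (balancedMk Q.ract V.ρ.toLinearMap)
    X.ρ.toLinearMap (evalBilin P Q e V hr) (fun _ _ _ => by simp) (fun _ _ _ => rfl)
    (P.δ p) (Q.δ q) z).symm.trans ?_
  refine (map₂_map_left X.ρ.toLinearMap V.ρ.toLinearMap X.ρ.toLinearMap
    (V.ρ.toLinearMap ∘ₗ e.toLinearMap) LinearMap.id e.toLinearMap (fun _ _ => rfl)
    (fun _ _ => rfl) _ z).symm.trans ?_
  refine Eq.trans ?_ (tensorRep_apply ComoduleAlgebra.coaction X.ρ V.ρ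
    (e (balancedMk P.ract Q.lact p q)) z).symm
  rw [hc]
  rfl

end CovariantBimodule

theorem ComoduleAlgebra.EquivariantlyMoritaEquivalent.topologicallyEquivalent
    (h : ComoduleAlgebra.EquivariantlyMoritaEquivalent H A B) :
    ComoduleAlgebra.TopologicallyEquivalent H A B := by
  obtain ⟨P, Q, ⟨e, hl, hr, hc⟩, ⟨e', hl', hr', hc'⟩⟩ := h
  have hα := CovariantBimodule.tensorδ_evalIso hl hr hc
  have hβ := CovariantBimodule.tensorδ_evalIso hl' hr' hc'
  exact ⟨Q.tensorFunctor,
    (CategoryTheory.Equivalence.mk Q.tensorFunctor P.tensorFunctor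
      (CovariantBimodule.evalIso hl hr).symm
      (CovariantBimodule.evalIso hl' hr')).isEquivalence_functor,
    inferInstance, inferInstance, ⟨leftLinearOfOplax _ (isIso_δₗ_of_comp
      (CovariantBimodule.evalIso hl hr) (CovariantBimodule.evalIso hl' hr') hα hβ)⟩⟩

end CovariantMorita

/-- When `H` acts on `X` by the counit, the counit axiom collapses the coaction. Thus the underlying
vector space of any module can be tensored on as a multiplicity space. -/
theorem tensorRep_trivial {H A X M : Type u} [Ring H] [Bialgebra ℂ H] [Ring A] [Algebra ℂ A]
    [AddCommGroup X] [Module ℂ X] [AddCommGroup M] [Module ℂ M] (β : A →ₐ[ℂ] H ⊗[ℂ] A)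
    (hβ : ∀ a, TensorProduct.lid ℂ A (Coalgebra.counit.rTensor A (β a)) = a)
    (ρM : A →ₐ[ℂ] Module.End ℂ M) (a : A) :
    tensorRep β ((Algebra.ofId ℂ (Module.End ℂ X)).comp (Bialgebra.counitAlgHom ℂ H)) ρM a =
      TensorProduct.map LinearMap.id (ρM a) := by
  conv_rhs => rw [← hβ a]
  refine LinearMap.ext fun t => ?_
  rw [tensorRep_apply]
  generalize β a = s
  induction s with
  | zero => simp
  | add s s' hs hs' =>
    simp only [map_add, LinearMap.add_apply, hs, hs', TensorProduct.map_add_right]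
  | tmul h b =>
    induction t with
    | zero => simp
    | add t t' ht ht' => simp only [map_add, ht, ht']
    | tmul x m => simp [Algebra.ofId_apply, TensorProduct.smul_tmul]

theorem map₂_mul_mul {H A : Type u} [Ring H] [Algebra ℂ H] [Ring A] [Algebra ℂ A]
    (s t : H ⊗[ℂ] A) :
    TensorProduct.map₂ (LinearMap.mul ℂ H) (LinearMap.mul ℂ A) s t = s * t := by
  induction s with
  | zero => simp
  | add s s' hs hs' => simp only [map_add, LinearMap.add_apply, hs, hs', add_mul]
  | tmul h a =>
    induction t with
    | zero => simp
    | add t t' ht ht' => simp only [map_add, ht, ht', mul_add]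
    | tmul h' a' => simp

theorem tensorRep_lmul {H A : Type u} [Ring H] [Algebra ℂ H] [Ring A] [Algebra ℂ A]
    (β : A →ₐ[ℂ] H ⊗[ℂ] A) (a : A) (t : H ⊗[ℂ] A) :
    tensorRep β (Algebra.lmul ℂ H) (Algebra.lmul ℂ A) a t = β a * t :=
  (tensorRep_apply _ _ _ _ _).trans (map₂_mul_mul _ _)

theorem lidEquiv_map_counit {H M : Type u} [Ring H] [Bialgebra ℂ H] [AddCommGroup M] [Module ℂ M]
    (s : H ⊗[ℂ] M) :
    lidEquiv M (TensorProduct.map ((ULift.moduleEquiv : ULift.{u} ℂ ≃ₗ[ℂ] ℂ).symm.toLinearMap ∘ₗ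
      (Coalgebra.counit : H →ₗ[ℂ] ℂ)) LinearMap.id s) =
      TensorProduct.lid ℂ M (Coalgebra.counit.rTensor M s) := by
  induction s with
  | zero => simp
  | add s s' hs hs' => simp only [map_add, hs, hs']
  | tmul h x => rfl

/-! ### Part (1): the covariant bimodule `F(A)` of a module functor -/

section Regular

open MonoidalLeftAction CategoryTheory.Functor.OplaxLeftLinear CategoryTheory.Functor.LaxLeftLinear

variable {H A B : Type u} [Ring H] [Bialgebra ℂ H]
  [Ring A] [Algebra ℂ A] [Ring B] [Algebra ℂ B]

variable (A) in
/-- The left regular module. -/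
abbrev regMod [FiniteDimensional ℂ A] : FDMod A where
  carrier := A
  ρ := Algebra.lmul ℂ A

/-- The morphism `a ↦ a v`. -/
def orbit [FiniteDimensional ℂ A] (V : FDMod A) (v : V.carrier) : regMod A ⟶ V :=
  FDMod.mkHom (V := regMod A) (V.ρ.toLinearMap.flip v)
    fun a => LinearMap.ext fun x => LinearMap.congr_fun (map_mul V.ρ a x) v

theorem orbit_one [FiniteDimensional ℂ A] : orbit (regMod A) (1 : A) = 𝟙 _ :=
  FDMod.hom_ext (LinearMap.ext fun a => mul_one a)

theorem orbit_comp [FiniteDimensional ℂ A] {V W : FDMod A} (v : V.carrier) (f : V ⟶ W) :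
    orbit V v ≫ f = orbit W (FDMod.toLin f v) :=
  FDMod.hom_ext (LinearMap.ext fun a => FDMod.toLin_ρ f a v)

/-- The bilinear map `F(A) × V → F(V)`, `(q, v) ↦ F(a ↦ a v)(q)`. -/
def evalFunctor [FiniteDimensional ℂ A] (F : FDMod A ⥤ FDMod B) [F.Additive] [F.Linear ℂ]
    (V : FDMod A) :
    (F.obj (regMod A)).carrier →ₗ[ℂ] V.carrier →ₗ[ℂ] (F.obj V).carrier :=
  LinearMap.mk₂ ℂ (fun q v => FDMod.toLin (F.map (orbit V v)) q)
    (fun q q' v => map_add _ q q') (fun c q v => map_smul _ c q)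
    (fun q v v' => by
      have : orbit V (v + v') = orbit V v + orbit V v' :=
        FDMod.hom_ext (LinearMap.ext fun a => map_add (V.ρ a) v v')
      rw [this, F.map_add]
      rfl)
    (fun c q v => by
      have : orbit V (c • v) = c • orbit V v :=
        FDMod.hom_ext (LinearMap.ext fun a => map_smul (V.ρ a) c v)
      rw [this, F.map_smul]
      rfl)

section

variable [FiniteDimensional ℂ A] (F : FDMod A ⥤ FDMod B) [F.Additive] [F.Linear ℂ]

theorem evalFunctor_apply {V : FDMod A} (q : (F.obj (regMod A)).carrier) (v : V.carrier) :
    evalFunctor F V q v = FDMod.toLin (F.map (orbit V v)) q := rfl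

theorem map_evalFunctor {V W : FDMod A} (f : V ⟶ W) (q : (F.obj (regMod A)).carrier)
    (v : V.carrier) :
    FDMod.toLin (F.map f) (evalFunctor F V q v) = evalFunctor F W q (FDMod.toLin f v) := by
  rw [evalFunctor_apply, evalFunctor_apply, ← orbit_comp, F.map_comp]
  rfl

theorem evalFunctor_one (q : (F.obj (regMod A)).carrier) :
    evalFunctor F (regMod A) q (1 : A) = q := by
  rw [evalFunctor_apply, orbit_one, F.map_id]
  rfl

/-- Functoriality for the factorisation of `x ↦ x a v` into right multiplication by `a` and the
orbit map of `v`. It gives associativity of the right action on `F(A)` and the balancing of `F(A) ×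
V → F(V)`. -/
theorem evalFunctor_ρ {V : FDMod A} (q : (F.obj (regMod A)).carrier) (a : A) (v : V.carrier) :
    evalFunctor F V q (V.ρ a v) = evalFunctor F V (evalFunctor F (regMod A) q a) v :=
  (map_evalFunctor F (orbit V v) q a).symm

theorem ρ_evalFunctor {V : FDMod A} (q : (F.obj (regMod A)).carrier) (b : B) (v : V.carrier) :
    evalFunctor F V ((F.obj (regMod A)).ρ b q) v = (F.obj V).ρ b (evalFunctor F V q v) :=
  FDMod.toLin_ρ (F.map (orbit V v)) b q

end

/-- The morphism `H ⟶ H ⊗ H` of left modules given by the comultiplication. -/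
def comulHom [FiniteDimensional ℂ H] : regMod H ⟶ regMod H ⊗ regMod H :=
  FDMod.mkHom (V := regMod H) (W := regMod H ⊗ regMod H) Coalgebra.comul fun h =>
    LinearMap.ext fun x =>
      ((Bialgebra.comul_mul h x).trans (tensorRep_lmul (Bialgebra.comulAlgHom ℂ H) h _).symm)

/-- The morphism `H ⟶ ℂ` of left modules given by the counit. -/
def counitHom [FiniteDimensional ℂ H] : regMod H ⟶ 𝟙_ (FDMod H) :=
  FDMod.mkHom (V := regMod H) (W := 𝟙_ (FDMod H))
    (ULift.moduleEquiv.symm.toLinearMap ∘ₗ Coalgebra.counit) fun h =>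
    LinearMap.ext fun x => congrArg ULift.up (Bialgebra.counit_mul h x)

variable [ComoduleAlgebra H A] [ComoduleAlgebra H B]

section

variable [FiniteDimensional ℂ H] [FiniteDimensional ℂ A]

variable (H A) in
/-- The morphism `A ⟶ H ⊗ A` of left `A`-modules given by the coaction. -/
def coactionHom : regMod A ⟶ regMod H ⊙ₗ regMod A :=
  FDMod.mkHom (V := regMod A) (W := regMod H ⊙ₗ regMod A)
    (ComoduleAlgebra.coaction (H := H) (A := A)).toLinearMap fun a =>
    LinearMap.ext fun x =>
      (map_mul (ComoduleAlgebra.coaction (H := H) (A := A)) a x).trans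
        (tensorRep_lmul (ComoduleAlgebra.coaction (H := H) (A := A)) a _).symm

/-- The comodule axiom of `A` as an identity between `A`-linear maps, so that `F` can be applied to
it. For this `H` enters as the regular representation and its comultiplication as a morphism in
`Rep(H)`. -/
theorem coactionHom_coassoc :
    coactionHom H A ≫ comulHom ⊵ₗ regMod A ≫ (αₗ (regMod H) (regMod H) (regMod A)).hom =
      coactionHom H A ≫ regMod H ⊴ₗ coactionHom H A :=
  FDMod.hom_ext (LinearMap.ext fun a => ComoduleAlgebra.coassoc (H := H) a)

theorem coactionHom_counit :
    coactionHom H A ≫ counitHom ⊵ₗ regMod A ≫ (λₗ (regMod A)).hom = 𝟙 _ :=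
  FDMod.hom_ext (LinearMap.ext fun a =>
    (lidEquiv_map_counit _).trans (ComoduleAlgebra.counit (H := H) a))

/-- For `s : H ⊗ V`, the morphism `u ↦ u s` from `H ⊗ A` to `H ⊗ V`. -/
def mulHom {V : FDMod A} (s : H ⊗[ℂ] V.carrier) :
    regMod H ⊙ₗ regMod A ⟶ regMod H ⊙ₗ V :=
  FDMod.mkHom (V := regMod H ⊙ₗ regMod A) (W := regMod H ⊙ₗ V)
    ((TensorProduct.map₂ (LinearMap.mul ℂ H) V.ρ.toLinearMap).flip s) fun a =>
    LinearMap.ext fun u => by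
      refine (congrArg (fun z => TensorProduct.map₂ (LinearMap.mul ℂ H) V.ρ.toLinearMap z s)
        (tensorRep_lmul (ComoduleAlgebra.coaction (H := H) (A := A)) a u)).trans ?_
      refine Eq.trans ?_ (tensorRep_apply (ComoduleAlgebra.coaction (H := H) (A := A))
        (Algebra.lmul ℂ H) V.ρ a _).symm
      rw [← map₂_mul_mul]
      exact map₂_map₂ (LinearMap.mul ℂ H) (LinearMap.mul ℂ A) (LinearMap.mul ℂ H)
        V.ρ.toLinearMap (LinearMap.mul ℂ H) V.ρ.toLinearMap (LinearMap.mul ℂ H) V.ρ.toLinearMap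
        (fun h h' x => mul_assoc h h' x) (fun a a' v => by simp) _ _ _

/-- The action of `a` on `H ⊗ V` is multiplication by its coaction, so every orbit map into `H ⊗ V`
factors through the coaction of `A`. -/
theorem orbit_eq_coactionHom_comp {V : FDMod A} (s : H ⊗[ℂ] V.carrier) :
    orbit (regMod H ⊙ₗ V) s = coactionHom H A ≫ mulHom s :=
  FDMod.hom_ext (LinearMap.ext fun a =>
    tensorRep_apply (ComoduleAlgebra.coaction (H := H) (A := A)) (Algebra.lmul ℂ H) V.ρ a s)

variable (F : FDMod A ⥤ FDMod B) [F.LeftLinear (FDMod H)]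

/-- The morphism `F(A) ⟶ H ⊗ F(A)` induced by the coaction of `A`. -/
def functorCoaction : F.obj (regMod A) ⟶ regMod H ⊙ₗ F.obj (regMod A) :=
  F.map (coactionHom H A) ≫ δₗ F (regMod H) (regMod A)

theorem functorCoaction_coassoc :
    functorCoaction (H := H) F ≫ comulHom ⊵ₗ F.obj (regMod A) ≫
        (αₗ (regMod H) (regMod H) (F.obj (regMod A))).hom =
      functorCoaction F ≫ regMod H ⊴ₗ functorCoaction F := by
  simp only [functorCoaction, Category.assoc, actionHomRight_comp]
  rw [← δₗ_naturality_left_assoc, δₗ_associativity, ← δₗ_naturality_right_assoc,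
    ← F.map_comp_assoc, ← F.map_comp_assoc, ← F.map_comp_assoc, Category.assoc,
    coactionHom_coassoc]

theorem functorCoaction_counit :
    functorCoaction (H := H) F ≫ counitHom ⊵ₗ F.obj (regMod A) ≫ (λₗ (F.obj (regMod A))).hom =
      𝟙 _ := by
  simp only [functorCoaction, Category.assoc]
  rw [← δₗ_naturality_left_assoc, δₗ_unitality_hom, ← F.map_comp, ← F.map_comp,
    coactionHom_counit, F.map_id]

variable [F.Additive] [F.Linear ℂ]

/-- Both sides are additive in `s`. For `s = h ⊗ v` the morphism is a tensor product of two orbit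
maps, and naturality of `δₗ` in each variable moves `F` past it. -/
theorem δₗ_map_mulHom {V : FDMod A} (s : H ⊗[ℂ] V.carrier)
    (y : (F.obj (regMod H ⊙ₗ regMod A)).carrier) :
    FDMod.toLin (F.map (mulHom s) ≫ δₗ F (regMod H) V) y =
      TensorProduct.map₂ (LinearMap.mul ℂ H) (evalFunctor F V)
        (FDMod.toLin (δₗ F (regMod H) (regMod A)) y) s := by
  induction s with
  | zero =>
    have : mulHom (0 : H ⊗[ℂ] V.carrier) = 0 :=
      FDMod.hom_ext (LinearMap.map_zero _)
    rw [this, F.map_zero, Limits.zero_comp, map_zero]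
    rfl
  | add s t hs ht =>
    have : mulHom (s + t) = mulHom s + mulHom t :=
      FDMod.hom_ext (LinearMap.map_add _ s t)
    rw [this, F.map_add, Preadditive.add_comp, map_add, ← hs, ← ht]
    rfl
  | tmul h v =>
    have : mulHom (h ⊗ₜ[ℂ] v) = orbit (regMod H) h ⊵ₗ regMod A ≫ regMod H ⊴ₗ orbit V v :=
      FDMod.hom_ext (TensorProduct.ext' fun x a => rfl)
    rw [this, F.map_comp, Category.assoc, δₗ_naturality_right, δₗ_naturality_left_assoc]
    rw [FDMod.comp_apply]
    generalize FDMod.toLin (δₗ F (regMod H) (regMod A)) y = z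
    refine LinearMap.congr_fun (f := FDMod.toLin (orbit (regMod H) h ⊵ₗ F.obj (regMod A) ≫
        regMod H ⊴ₗ F.map (orbit V v)))
      (g := (TensorProduct.map₂ (LinearMap.mul ℂ H) (evalFunctor F V)).flip (h ⊗ₜ v))
      (TensorProduct.ext' fun x q => rfl) z

/-- The orbit map of `v` followed by `f` is the orbit map of `f(v)`, hence factors through the
coaction of `A`. Taking `f` to be that coaction gives right covariance of `F(A)`; taking `f` to be
the coaction of another such bimodule gives colinearity of the final isomorphism. -/
theorem δₗ_map_evalFunctor {V W : FDMod A} (f : V ⟶ regMod H ⊙ₗ W)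
    (q : (F.obj (regMod A)).carrier) (v : V.carrier) :
    FDMod.toLin (F.map f ≫ δₗ F (regMod H) W) (evalFunctor F V q v) =
      TensorProduct.map₂ (LinearMap.mul ℂ H) (evalFunctor F W)
        (FDMod.toLin (functorCoaction F) q) (FDMod.toLin f v) := by
  have h : F.map (orbit V v) ≫ F.map f ≫ δₗ F (regMod H) W =
      F.map (coactionHom H A) ≫ F.map (mulHom (FDMod.toLin f v)) ≫ δₗ F (regMod H) W := by
    rw [← F.map_comp_assoc, orbit_comp, orbit_eq_coactionHom_comp, F.map_comp, Category.assoc]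
  exact (FDMod.congr_toLin h q).trans (δₗ_map_mulHom F _ _)

/-- The `H`-covariant bimodule `F(A)` determined by a module functor `F`. -/
def CovariantBimodule.ofFunctor : CovariantBimodule H B A where
  carrier := (F.obj (regMod A)).carrier
  lact := (F.obj (regMod A)).ρ.toLinearMap
  one_lact p := by simp
  mul_lact b b' p := by simp
  ract := evalFunctor F (regMod A)
  ract_one := evalFunctor_one F
  ract_mul p a a' := evalFunctor_ρ F p a (V := regMod A) a'
  lact_ract b p a := (ρ_evalFunctor F p b (V := regMod A) a).symm
  δ := FDMod.toLin (functorCoaction F)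
  coassoc p := FDMod.congr_toLin (functorCoaction_coassoc F) p
  counit p := (lidEquiv_map_counit _).symm.trans
    (FDMod.congr_toLin (functorCoaction_counit (H := H) F) p)
  δ_lact b p := (FDMod.toLin_ρ (functorCoaction F) b p).trans (tensorRep_apply _ _ _ _ _)
  δ_ract p a := δₗ_map_evalFunctor F (coactionHom H A) p a

end

end Regular

theorem FDMod.epi_of_surjective {A : Type u} [Ring A] [Algebra ℂ A] {V W : FDMod A} (f : V ⟶ W)
    (hf : Function.Surjective (FDMod.toLin f)) : Epi f where
  left_cancellation g h hgh := FDMod.hom_ext (LinearMap.ext fun w => by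
    obtain ⟨v, rfl⟩ := hf w
    exact FDMod.congr_toLin hgh v)

/-! ### Part (1): equivalence of module categories implies equivariant Morita equivalence -/

section Converse

open MonoidalLeftAction CategoryTheory.Functor.OplaxLeftLinear CategoryTheory.Functor.LaxLeftLinear

variable {H A B : Type u} [Ring H] [Bialgebra ℂ H]
  [Ring A] [Algebra ℂ A] [Ring B] [Algebra ℂ B]
  [ComoduleAlgebra H B]

variable (H) in
/-- The underlying space of a module, as a trivial representation of `H`. -/
abbrev trivialMod (V : FDMod A) : FDMod H where
  carrier := V.carrier
  ρ := (Algebra.ofId ℂ (Module.End ℂ V.carrier)).comp (Bialgebra.counitAlgHom ℂ H)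

/-- The morphism from the trivial one-dimensional representation given by a vector. -/
def pointHom (V : FDMod A) (v : V.carrier) : 𝟙_ (FDMod H) ⟶ trivialMod H V :=
  FDMod.mkHom (V := 𝟙_ (FDMod H)) (W := trivialMod H V)
    (LinearMap.toSpanSingleton ℂ V.carrier v ∘ₗ ULift.moduleEquiv.toLinearMap) fun h =>
    LinearMap.ext fun c => mul_smul (Coalgebra.counit h : ℂ) c.down v

/-- The morphism `m ↦ v ⊗ m`. -/
def insertHom (V : FDMod A) (v : V.carrier) (M : FDMod B) : M ⟶ trivialMod H V ⊙ₗ M :=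
  (λₗ M).inv ≫ pointHom V v ⊵ₗ M

theorem insertHom_apply (V : FDMod A) (v : V.carrier) (M : FDMod B) (m : M.carrier) :
    FDMod.toLin (insertHom (H := H) V v M) m = v ⊗ₜ[ℂ] m := by
  change ((1 : ℂ) • v) ⊗ₜ[ℂ] m = _
  rw [one_smul]

variable [ComoduleAlgebra H A]

/-- Naturality of `δₗ` along `ℂ → V` together with unitality: under `F(V ⊗ M) ≅ V ⊗ F(M)`, for `V` a
trivial representation, the copies of `M` indexed by vectors match those of `F(M)`. This replaces
choosing a basis of `V`. -/
theorem map_insertHom_comp_δₗ (F : FDMod A ⥤ FDMod B) [F.LeftLinear (FDMod H)] (V M : FDMod A)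
    (v : V.carrier) :
    F.map (insertHom V v M) ≫ δₗ F (trivialMod H V) M = insertHom V v (F.obj M) := by
  rw [insertHom, insertHom, F.map_comp, Category.assoc, δₗ_naturality_left, δₗ_unitality_inv,
    Category.assoc]

variable [FiniteDimensional ℂ A]

variable (H) in
/-- The morphism `V ⊗ A ⟶ V`, `v ⊗ a ↦ a v`, where `V` is a trivial representation of `H`. -/
def actionHomTrivial (V : FDMod A) : trivialMod H V ⊙ₗ regMod A ⟶ V :=
  FDMod.mkHom (V := trivialMod H V ⊙ₗ regMod A) (W := V)
    (TensorProduct.lift V.ρ.toLinearMap.flip) fun a => by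
      refine (congrArg (fun f => TensorProduct.lift V.ρ.toLinearMap.flip ∘ₗ f)
        (tensorRep_trivial (X := V.carrier) (ComoduleAlgebra.coaction (H := H) (A := A))
          ComoduleAlgebra.counit (Algebra.lmul ℂ A) a)).trans ?_
      exact TensorProduct.ext' fun v x => LinearMap.congr_fun (map_mul V.ρ a x) v

theorem insertHom_comp_actionHomTrivial (V : FDMod A) (v : V.carrier) :
    insertHom V v (regMod A) ≫ actionHomTrivial H V = orbit V v :=
  FDMod.hom_ext (LinearMap.ext fun a =>
    congrArg (FDMod.toLin (actionHomTrivial H V)) (insertHom_apply V v (regMod A) a))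

instance (V : FDMod A) : Epi (actionHomTrivial H V) :=
  FDMod.epi_of_surjective _ fun v => ⟨v ⊗ₜ[ℂ] (1 : A), LinearMap.congr_fun (map_one V.ρ) v⟩

variable [FiniteDimensional ℂ H]

/-- The morphism `F(A) ⊗_A V ⟶ F(V)`, `q ⊗ v ↦ F(a ↦ a v)(q)`. -/
def evalFunctorHom (F : FDMod A ⥤ FDMod B) [F.Additive] [F.Linear ℂ] [F.LeftLinear (FDMod H)]
    (V : FDMod A) : (CovariantBimodule.ofFunctor (H := H) F).tensor V ⟶ F.obj V :=
  FDMod.mkHom (V := (CovariantBimodule.ofFunctor (H := H) F).tensor V)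
    (balancedLift (evalFunctor F V) fun q a v => (evalFunctor_ρ F q a v).symm)
    fun b => balanced_hom_ext fun q v => ρ_evalFunctor F q b v

variable (F : FDMod A ⥤ FDMod B) [F.Additive] [F.Linear ℂ] [F.LeftLinear (FDMod H)]

/-- The projection `V ⊗ F(A) ⟶ F(A) ⊗_A V`, `v ⊗ q ↦ q ⊗ v`. -/
def balancedProj (V : FDMod A) :
    trivialMod H V ⊙ₗ F.obj (regMod A) ⟶ (CovariantBimodule.ofFunctor (H := H) F).tensor V :=
  FDMod.mkHom (V := trivialMod H V ⊙ₗ F.obj (regMod A))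
    (W := (CovariantBimodule.ofFunctor (H := H) F).tensor V)
    (TensorProduct.lift (balancedMk (evalFunctor F (regMod A)) V.ρ.toLinearMap).flip) fun b => by
      refine (congrArg (fun f => TensorProduct.lift
        (balancedMk (evalFunctor F (regMod A)) V.ρ.toLinearMap).flip ∘ₗ f)
        (tensorRep_trivial (X := V.carrier) (ComoduleAlgebra.coaction (H := H) (A := B))
          ComoduleAlgebra.counit (F.obj (regMod A)).ρ b)).trans ?_
      exact TensorProduct.ext' fun v x => rfl

theorem insertHom_comp_balancedProj (V : FDMod A) (v : V.carrier)
    (q : (F.obj (regMod A)).carrier) :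
    FDMod.toLin (insertHom V v (F.obj (regMod A)) ≫ balancedProj (H := H) F V) q =
      balancedMk (evalFunctor F (regMod A)) V.ρ.toLinearMap q v :=
  congrArg (FDMod.toLin (balancedProj (H := H) F V)) (insertHom_apply V v (F.obj (regMod A)) q)

instance (V : FDMod A) : Epi (balancedProj (H := H) F V) :=
  FDMod.epi_of_surjective _ fun t => by
    refine balanced_induction
      (motive := fun t => ∃ s, FDMod.toLin (balancedProj (H := H) F V) s = t)
      ⟨0, map_zero _⟩ ?_ (fun q v => ⟨v ⊗ₜ[ℂ] q, rfl⟩) t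
    rintro _ _ ⟨s, rfl⟩ ⟨t, rfl⟩
    exact ⟨s + t, map_add _ s t⟩

/-- The comparison map is covered by `V ⊗ F(A) ≅ F(V ⊗ A) → F(V)`, the image of the free
presentation `V ⊗ A → V`. -/
theorem balancedProj_comp_evalFunctorHom (V : FDMod A) :
    balancedProj F V ≫ evalFunctorHom (H := H) F V =
      μₗ F (trivialMod H V) (regMod A) ≫ F.map (actionHomTrivial H V) := by
  refine FDMod.hom_ext (TensorProduct.ext' fun v q => ?_)
  have h1 : insertHom V v (F.obj (regMod A)) ≫ μₗ F (trivialMod H V) (regMod A) ≫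
      F.map (actionHomTrivial H V) = F.map (orbit V v) := by
    rw [← map_insertHom_comp_δₗ, Category.assoc,
      CategoryTheory.Functor.LeftLinear.δₗ_comp_μₗ_assoc, ← F.map_comp,
      insertHom_comp_actionHomTrivial]
  refine (FDMod.congr_toLin h1 q).symm.trans ?_
  exact congrArg (FDMod.toLin (μₗ F (trivialMod H V) (regMod A) ≫ F.map (actionHomTrivial H V)))
    (insertHom_apply V v (F.obj (regMod A)) q)

/-- In place of preservation of cokernels, the projection to `F(A) ⊗_A V` is pulled back through the
equivalence to a map out of `V ⊗ A`, where factoring through `V` can be tested on elements. -/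
theorem exists_lift_balancedProj [F.IsEquivalence] (V : FDMod A) :
    ∃ ψ : F.obj V ⟶ (CovariantBimodule.ofFunctor (H := H) F).tensor V,
      F.map (actionHomTrivial H V) ≫ ψ =
        δₗ F (trivialMod H V) (regMod A) ≫ balancedProj F V := by
  set W := (CovariantBimodule.ofFunctor (H := H) F).tensor V with hW
  let i := F.objObjPreimageIso W
  let g : trivialMod H V ⊙ₗ regMod A ⟶ F.objPreimage W :=
    F.preimage (δₗ F (trivialMod H V) (regMod A) ≫ balancedProj F V ≫ i.inv)
  have hg : F.map g = δₗ F (trivialMod H V) (regMod A) ≫ balancedProj F V ≫ i.inv :=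
    F.map_preimage _
  -- After applying the faithful functor `F`, this becomes the defining relation `q a ⊗ v = q ⊗ a v`
  -- of `F(A) ⊗_A V`.
  have key : ∀ (v : V.carrier) (a : A), orbit (regMod A) a ≫ insertHom V v (regMod A) ≫ g =
      insertHom V (V.ρ a v) (regMod A) ≫ g := by
    intro v a
    have h : F.map (orbit (regMod A) a) ≫ insertHom V v (F.obj (regMod A)) ≫
        balancedProj (H := H) F V =
        insertHom V (V.ρ a v) (F.obj (regMod A)) ≫ balancedProj F V := by
      refine FDMod.hom_ext (LinearMap.ext fun q => ?_)
      refine (insertHom_comp_balancedProj F V v _).trans ?_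
      refine Eq.trans ?_ (insertHom_comp_balancedProj F V (V.ρ a v) q).symm
      exact balancedMk_ract (ract := evalFunctor F (regMod A)) (lact := V.ρ.toLinearMap) q a v
    refine F.map_injective ?_
    simp only [F.map_comp, hg]
    rw [← Category.assoc (F.map (insertHom V v (regMod A))), map_insertHom_comp_δₗ,
      ← Category.assoc (F.map (insertHom V (V.ρ a v) (regMod A))), map_insertHom_comp_δₗ,
      ← Category.assoc (insertHom V (V.ρ a v) _), ← h]
    simp only [Category.assoc]
  have key' : ∀ (v : V.carrier) (a : A), FDMod.toLin g (v ⊗ₜ[ℂ] a) =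
      FDMod.toLin g (V.ρ a v ⊗ₜ[ℂ] (1 : A)) := by
    intro v a
    have h := FDMod.congr_toLin (key v a) (1 : A)
    refine Eq.trans ?_ (h.trans ?_)
    · refine congrArg (FDMod.toLin g) ?_
      refine Eq.trans ?_ (insertHom_apply V v (regMod A) _).symm
      exact congrArg (v ⊗ₜ[ℂ] ·) (one_mul a).symm
    · exact congrArg (FDMod.toLin g) (insertHom_apply V _ (regMod A) _)
  -- The factorisation is `v ↦ g(v ⊗ 1)`. It is `A`-linear since `g(a v ⊗ 1) = g(v ⊗ a) = a g(v ⊗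
  -- 1)`, where `A` acts only on the second factor.
  let gbar : V ⟶ F.objPreimage W := FDMod.mkHom
    (FDMod.toLin g ∘ₗ (TensorProduct.mk ℂ V.carrier A).flip 1) fun a => by
      refine LinearMap.ext fun v => (key' v a).symm.trans ?_
      refine Eq.trans ?_ (FDMod.toLin_ρ g a (v ⊗ₜ[ℂ] (1 : A)))
      refine congrArg (FDMod.toLin g) ?_
      refine Eq.trans ?_ (LinearMap.congr_fun (tensorRep_trivial (X := V.carrier)
        (ComoduleAlgebra.coaction (H := H) (A := A))
          ComoduleAlgebra.counit (Algebra.lmul ℂ A) a) (v ⊗ₜ[ℂ] (1 : A))).symm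
      exact congrArg (v ⊗ₜ[ℂ] ·) (mul_one a).symm
  have hgbar : actionHomTrivial H V ≫ gbar = g :=
    FDMod.hom_ext (TensorProduct.ext' fun v a => (key' v a).symm)
  refine ⟨F.map gbar ≫ i.hom, ?_⟩
  rw [← F.map_comp_assoc, hgbar, hg]
  simp

/-- Source and target are both quotients of `V ⊗ F(A)`, and the comparison map and `ψ` are maps
under it; both composites are identities after cancelling epimorphisms. -/
theorem isIso_evalFunctorHom [F.IsEquivalence] (V : FDMod A) :
    IsIso (evalFunctorHom (H := H) F V) := by
  obtain ⟨ψ, hψ⟩ := exists_lift_balancedProj (H := H) F V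
  have h1 := balancedProj_comp_evalFunctorHom (H := H) F V
  have h2 : μₗ F (trivialMod H V) (regMod A) ≫ F.map (actionHomTrivial H V) ≫ ψ =
      balancedProj F V := by rw [hψ]; simp
  refine ⟨ψ, ?_, ?_⟩
  · rw [← cancel_epi (balancedProj (H := H) F V), ← Category.assoc, h1, Category.assoc, h2,
      Category.comp_id]
  · rw [← cancel_epi (F.map (actionHomTrivial H V)),
      ← cancel_epi (μₗ F (trivialMod H V) (regMod A)), Category.comp_id, ← h1,
      ← Category.assoc (F.map _), ← Category.assoc, h2]

variable {F} [FiniteDimensional ℂ B] {G : FDMod B ⥤ FDMod A} [G.Additive] [G.Linear ℂ]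
  [G.LeftLinear (FDMod H)] [G.IsEquivalence]

/-- The isomorphism is `G(B) ⊗_B F(A) ≅ G(F(A)) ≅ A`. Left linearity is automatic, as it is a
morphism of `A`-modules; right linearity is naturality, and colinearity is `hα`. -/
theorem CovariantBimodule.tensorIsoRegular_ofFunctor (α : F ⋙ G ≅ 𝟭 (FDMod A))
    (hα : ∀ (X : FDMod H) V, G.map (μₗ F X V) ≫ α.hom.app (X ⊙ₗ V) =
      δₗ G X (F.obj V) ≫ X ⊴ₗ α.hom.app V) :
    (ofFunctor (H := H) G).TensorIsoRegular (ofFunctor (H := H) F) := by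
  have := isIso_evalFunctorHom (H := H) G (F.obj (regMod A))
  let i := asIso (evalFunctorHom (H := H) G (F.obj (regMod A))) ≪≫ α.app (regMod A)
  let e : BalancedTensor (ofFunctor (H := H) G).ract (ofFunctor (H := H) F).lact ≃ₗ[ℂ] A :=
    LinearEquiv.ofLinearMap (FDMod.toLin i.hom) (FDMod.toLin i.inv)
      (LinearMap.ext fun x => FDMod.congr_toLin i.inv_hom_id x)
      (LinearMap.ext fun x => FDMod.congr_toLin i.hom_inv_id x)
  have he : ∀ p q, e (balancedMk _ _ p q) =
    FDMod.toLin (α.hom.app (regMod A)) (evalFunctor G (F.obj (regMod A)) p q) := fun p q => rfl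
  refine ⟨e, fun a p q =>
    FDMod.toLin_ρ i.hom a (balancedMk (ofFunctor G).ract (ofFunctor F).lact p q),
    fun p q a => ?_, fun p q => ?_⟩
  · rw [he, he]
    -- The right action of `a` on `F(A)` is `F` of right multiplication by `a`, so naturality of the
    -- evaluation and of `α` carries it to right multiplication on `A`.
    refine (congrArg (FDMod.toLin (α.hom.app (regMod A)))
      (map_evalFunctor G (F.map (orbit (regMod A) a)) p q).symm).trans ?_
    exact FDMod.congr_toLin (α.hom.naturality (orbit (regMod A) a)) _
  -- Naturality of `α` at the coaction of `A`, combined with `hα`, expresses the coaction of `A`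
  -- through that of `F(A)` and the structure map of `G`.
  · have h1 : α.hom.app (regMod A) ≫ coactionHom H A =
        G.map (functorCoaction F) ≫ δₗ G (regMod H) (F.obj (regMod A)) ≫
          regMod H ⊴ₗ α.hom.app (regMod A) := by
      rw [← hα, ← G.map_comp_assoc, functorCoaction, Category.assoc,
        CategoryTheory.Functor.LeftLinear.δₗ_comp_μₗ, Category.comp_id]
      exact (α.hom.naturality (coactionHom H A)).symm
    have h3 := δₗ_map_evalFunctor G (functorCoaction (H := H) F) p q
    refine (FDMod.congr_toLin h1 (evalFunctor G (F.obj (regMod A)) p q)).trans ?_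
    refine (congrArg (FDMod.toLin (regMod H ⊴ₗ α.hom.app (regMod A))) h3).trans ?_
    refine (map_map₂_left _ _ (LinearMap.mul ℂ H)
      ((evalFunctor G (F.obj (regMod A))).compr₂ (FDMod.toLin (α.hom.app (regMod A)))) _ _
      (fun _ _ => rfl) (fun _ _ => rfl) _ _).trans ?_
    exact (map_map₂_left (LinearMap.mul ℂ H) (balancedMk (ofFunctor G).ract (ofFunctor F).lact)
      (LinearMap.mul ℂ H)
      ((evalFunctor G (F.obj (regMod A))).compr₂ (FDMod.toLin (α.hom.app (regMod A))))
      LinearMap.id e.toLinearMap (fun _ _ => rfl) (fun _ _ => rfl) _ _).symm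

theorem ComoduleAlgebra.TopologicallyEquivalent.equivariantlyMoritaEquivalent
    (h : ComoduleAlgebra.TopologicallyEquivalent H A B) :
    ComoduleAlgebra.EquivariantlyMoritaEquivalent H A B := by
  obtain ⟨F, _, _, _, ⟨hF⟩⟩ := h
  let E := F.asEquivalence
  have : E.functor.LeftLinear (FDMod H) := hF
  have : E.functor.Additive := ‹F.Additive›
  have : E.functor.Linear ℂ := ‹F.Linear ℂ›
  let α : E.functor ⋙ E.inverse ≅ 𝟭 _ := E.unitIso.symm
  exact ⟨CovariantBimodule.ofFunctor E.inverse, CovariantBimodule.ofFunctor E.functor,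
    CovariantBimodule.tensorIsoRegular_ofFunctor α (map_μₗ_comp_unitComponent E),
    CovariantBimodule.tensorIsoRegular_ofFunctor E.counitIso (map_μₗ_comp_counitComponent E)⟩

end Converse

/-! ### Part (2): the `H`-action on a balanced tensor product -/

section BalancedRep

variable {H M N V P : Type u} [Ring H] [Bialgebra ℂ H] [Ring M] [Algebra ℂ M]
  [Ring N] [Algebra ℂ N]
  [AddCommGroup V] [Module ℂ V] [AddCommGroup P] [Module ℂ P]
  {ract : V →ₗ[ℂ] M →ₗ[ℂ] V} {lact : M →ₗ[ℂ] P →ₗ[ℂ] P}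
  {ρV : H →ₐ[ℂ] Module.End ℂ V} {ρM : H →ₐ[ℂ] Module.End ℂ M} {ρP : H →ₐ[ℂ] Module.End ℂ P}

/-- The tensor product of two representations of `H`. -/
abbrev tensorRepH (ρV : H →ₐ[ℂ] Module.End ℂ V) (ρP : H →ₐ[ℂ] Module.End ℂ P) :
    H →ₐ[ℂ] Module.End ℂ (V ⊗[ℂ] P) := tensorRep (Bialgebra.comulAlgHom ℂ H) ρV ρP

/-- The balancing relation for arbitrary tensors: acting by `h` through its comultiplication does
not preserve pure tensors, so the relation on pure tensors alone does not suffice. -/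
theorem mkQ_balanced (t : (V ⊗[ℂ] M) ⊗[ℂ] P) :
    (balancedRelations ract lact).mkQ (TensorProduct.map (TensorProduct.lift ract) LinearMap.id t) =
      (balancedRelations ract lact).mkQ (TensorProduct.map LinearMap.id (TensorProduct.lift lact)
        (TensorProduct.assoc ℂ V M P t)) := by
  refine LinearMap.congr_fun (f := (balancedRelations ract lact).mkQ ∘ₗ
    TensorProduct.map (TensorProduct.lift ract) LinearMap.id)
    (g := (balancedRelations ract lact).mkQ ∘ₗ TensorProduct.map LinearMap.id
      (TensorProduct.lift lact) ∘ₗ (TensorProduct.assoc ℂ V M P).toLinearMap)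
    (TensorProduct.ext_threefold fun v m p => ?_) t
  exact balancedMk_ract v m p

/-- The relations are differences of the two maps `V ⊗ M ⊗ P ⇉ V ⊗ P`, and both maps are `H`-linear.
-/
theorem tensorRep_mem_balancedRelations
    (hV : ∀ h, ρV h ∘ₗ TensorProduct.lift ract = TensorProduct.lift ract ∘ₗ tensorRepH ρV ρM h)
    (hP : ∀ h, ρP h ∘ₗ TensorProduct.lift lact = TensorProduct.lift lact ∘ₗ tensorRepH ρM ρP h)
    (h : H) : balancedRelations ract lact ≤
      (balancedRelations ract lact).comap (tensorRepH ρV ρP h) := by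
  refine Submodule.span_le.2 ?_
  rintro _ ⟨v, m, p, rfl⟩
  change tensorRepH ρV ρP h _ ∈ balancedRelations ract lact
  rw [map_sub, ← Submodule.Quotient.mk_eq_zero, Submodule.Quotient.mk_sub, sub_eq_zero]
  have h1 := LinearMap.congr_fun (tensorRep_map (Bialgebra.comulAlgHom ℂ H) (tensorRepH ρV ρM) ρP
    ρV ρP (TensorProduct.lift ract) LinearMap.id (fun h => (hV h).symm) (fun _ => rfl) h)
    ((v ⊗ₜ m) ⊗ₜ p)
  have h2 := LinearMap.congr_fun (tensorRep_map (Bialgebra.comulAlgHom ℂ H) ρV (tensorRepH ρM ρP)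
    ρV ρP LinearMap.id (TensorProduct.lift lact) (fun _ => rfl) (fun h => (hP h).symm) h)
    (v ⊗ₜ (m ⊗ₜ p))
  have h3 := LinearMap.congr_fun (tensorRep_assoc (Bialgebra.comulAlgHom ℂ H) comul_coassoc'
    ρV ρM ρP h) ((v ⊗ₜ m) ⊗ₜ p)
  refine (congrArg (balancedRelations ract lact).mkQ h1.symm).trans ?_
  refine (mkQ_balanced _).trans ?_
  refine Eq.trans ?_ (congrArg (balancedRelations ract lact).mkQ h2)
  exact congrArg (fun z => (balancedRelations ract lact).mkQ
    (TensorProduct.map LinearMap.id (TensorProduct.lift lact) z)) h3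

/-- The representation of `H` on `V ⊗_M P`. -/
def balancedRep
    (hV : ∀ h, ρV h ∘ₗ TensorProduct.lift ract = TensorProduct.lift ract ∘ₗ tensorRepH ρV ρM h)
    (hP : ∀ h, ρP h ∘ₗ TensorProduct.lift lact = TensorProduct.lift lact ∘ₗ tensorRepH ρM ρP h) :
    H →ₐ[ℂ] Module.End ℂ (BalancedTensor ract lact) :=
  AlgHom.ofLinearMap
    { toFun h := (balancedRelations ract lact).mapQ (balancedRelations ract lact)
        (tensorRepH ρV ρP h) (tensorRep_mem_balancedRelations hV hP h)
      map_add' h h' := Submodule.linearMap_qext _ (LinearMap.ext fun t => by simp)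
      map_smul' c h := Submodule.linearMap_qext _ (LinearMap.ext fun t => by simp) }
    (Submodule.linearMap_qext _ (LinearMap.ext fun t => by simp))
    (fun h h' => Submodule.linearMap_qext _ (LinearMap.ext fun t => by simp))

theorem mkQ_comp_tensorRep
    (hV : ∀ h, ρV h ∘ₗ TensorProduct.lift ract = TensorProduct.lift ract ∘ₗ tensorRepH ρV ρM h)
    (hP : ∀ h, ρP h ∘ₗ TensorProduct.lift lact = TensorProduct.lift lact ∘ₗ tensorRepH ρM ρP h)
    (h : H) : (balancedRelations ract lact).mkQ ∘ₗ tensorRepH ρV ρP h =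
      balancedRep hV hP h ∘ₗ (balancedRelations ract lact).mkQ := rfl

/-- The right action of `N` on `V ⊗_M P` induced by a commuting right action on `P`. -/
def balancedRact (ract : V →ₗ[ℂ] M →ₗ[ℂ] V) {lact : M →ₗ[ℂ] P →ₗ[ℂ] P} (r : P →ₗ[ℂ] N →ₗ[ℂ] P)
    (hr : ∀ m p n, lact m (r p n) = r (lact m p) n) :
    BalancedTensor ract lact →ₗ[ℂ] N →ₗ[ℂ] BalancedTensor ract lact :=
  balancedLift
    { toFun v := r.compr₂ (balancedMk ract lact v)
      map_add' v v' := by ext; simp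
      map_smul' c v := by ext; simp }
    fun v m p => LinearMap.ext fun n => (balancedMk_ract v m (r p n)).trans
      (congrArg (balancedMk ract lact v) (hr m p n))

theorem lift_balancedRact (r : P →ₗ[ℂ] N →ₗ[ℂ] P) (hr : ∀ m p n, lact m (r p n) = r (lact m p) n)
    (t : (V ⊗[ℂ] P) ⊗[ℂ] N) :
    TensorProduct.lift (balancedRact ract r hr)
      (TensorProduct.map (balancedRelations ract lact).mkQ LinearMap.id t) =
    (balancedRelations ract lact).mkQ (TensorProduct.map LinearMap.id (TensorProduct.lift r)
      (TensorProduct.assoc ℂ V P N t)) := by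
  refine LinearMap.congr_fun (f := TensorProduct.lift (balancedRact ract r hr) ∘ₗ
    TensorProduct.map (balancedRelations ract lact).mkQ LinearMap.id)
    (g := (balancedRelations ract lact).mkQ ∘ₗ TensorProduct.map LinearMap.id
      (TensorProduct.lift r) ∘ₗ (TensorProduct.assoc ℂ V P N).toLinearMap)
    (TensorProduct.ext_threefold fun v m p => rfl) t

theorem balancedRact_equivariant {ρN : H →ₐ[ℂ] Module.End ℂ N}
    (hV : ∀ h, ρV h ∘ₗ TensorProduct.lift ract = TensorProduct.lift ract ∘ₗ tensorRepH ρV ρM h)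
    (hP : ∀ h, ρP h ∘ₗ TensorProduct.lift lact = TensorProduct.lift lact ∘ₗ tensorRepH ρM ρP h)
    (r : P →ₗ[ℂ] N →ₗ[ℂ] P) (hr : ∀ m p n, lact m (r p n) = r (lact m p) n)
    (hN : ∀ h, ρP h ∘ₗ TensorProduct.lift r = TensorProduct.lift r ∘ₗ tensorRepH ρP ρN h) (h : H) :
    balancedRep hV hP h ∘ₗ TensorProduct.lift (balancedRact ract r hr) =
      TensorProduct.lift (balancedRact ract r hr) ∘ₗ tensorRepH (balancedRep hV hP) ρN h := by
  refine LinearMap.ext fun t => ?_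
  -- Lifting to `V ⊗ P ⊗ N` reduces the claim to equivariance of the unbalanced maps and of the
  -- associator.
  obtain ⟨s, rfl⟩ := TensorProduct.map_surjective (balancedRelations ract lact).mkQ_surjective
    (Function.surjective_id (α := N)) (g' := LinearMap.id) t
  have h1 := LinearMap.congr_fun (tensorRep_map (Bialgebra.comulAlgHom ℂ H) (tensorRepH ρV ρP) ρN
    (balancedRep hV hP) ρN (balancedRelations ract lact).mkQ LinearMap.id
    (mkQ_comp_tensorRep hV hP) (fun _ => rfl) h) s
  have h2 := LinearMap.congr_fun (tensorRep_map (Bialgebra.comulAlgHom ℂ H) ρV (tensorRepH ρP ρN)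
    ρV ρP LinearMap.id (TensorProduct.lift r) (fun _ => rfl) (fun h => (hN h).symm) h)
    (TensorProduct.assoc ℂ V P N s)
  have h3 := LinearMap.congr_fun (tensorRep_assoc (Bialgebra.comulAlgHom ℂ H) comul_coassoc'
    ρV ρP ρN h) s
  refine (congrArg (balancedRep hV hP h) (lift_balancedRact r hr s)).trans ?_
  refine (congrArg (balancedRelations ract lact).mkQ h2.symm).trans ?_
  refine Eq.trans ?_ (congrArg (TensorProduct.lift (balancedRact ract r hr)) h1)
  refine Eq.trans ?_ (lift_balancedRact r hr _).symm
  exact congrArg (fun z => (balancedRelations ract lact).mkQ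
    (TensorProduct.map LinearMap.id (TensorProduct.lift r) z)) h3.symm

end BalancedRep

theorem RightModRep.congr_toLin {H M : Type u} [Ring H] [Bialgebra ℂ H] [Ring M] [Algebra ℂ M]
    [ModuleAlgebra H M] {U V : RightModRep H M} {f g : U ⟶ V} (h : f = g) (x : U.carrier) :
    RightModRep.toLin f x = RightModRep.toLin g x := by rw [h]

theorem RightModRep.toLin_ρ {H M : Type u} [Ring H] [Bialgebra ℂ H] [Ring M] [Algebra ℂ M]
    [ModuleAlgebra H M] {U V : RightModRep H M} (f : U ⟶ V) (h : H) (x : U.carrier) :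
    RightModRep.toLin f (U.ρ h x) = V.ρ h (RightModRep.toLin f x) :=
  LinearMap.congr_fun (f.2.1 h) x

theorem RightModRep.toLin_ract {H M : Type u} [Ring H] [Bialgebra ℂ H] [Ring M] [Algebra ℂ M]
    [ModuleAlgebra H M] {U V : RightModRep H M} (f : U ⟶ V) (x : U.carrier) (m : M) :
    RightModRep.toLin f (U.ract x m) = V.ract (RightModRep.toLin f x) m := f.2.2 x m

/-! ### Part (2): the oplax module functor attached to a bimodule in `Rep(H)` -/

section BimoduleTensor

open MonoidalLeftAction

variable {H M N : Type u} [Ring H] [Bialgebra ℂ H]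
  [Ring M] [Algebra ℂ M] [ModuleAlgebra H M] [Ring N] [Algebra ℂ N] [ModuleAlgebra H N]

namespace BimoduleRep

/-- The right `N`-module `V ⊗_M P` in `Rep(H)`. -/
def tensor (P : BimoduleRep H M N) (V : RightModRep H M) : RightModRep H N where
  carrier := BalancedTensor V.ract P.lact
  ρ := balancedRep V.equivariant P.lact_equivariant
  ract := balancedRact V.ract P.ract P.lact_ract
  ract_one t := LinearMap.congr_fun
    (f := (balancedRact V.ract P.ract P.lact_ract).flip 1) (g := LinearMap.id)
    (balanced_hom_ext fun v p => congrArg (balancedMk V.ract P.lact v) (P.ract_one p)) t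
  ract_mul t n n' := LinearMap.congr_fun
    (f := (balancedRact V.ract P.ract P.lact_ract).flip (n * n'))
    (g := (balancedRact V.ract P.ract P.lact_ract).flip n' ∘ₗ
      (balancedRact V.ract P.ract P.lact_ract).flip n)
    (balanced_hom_ext fun v p => congrArg (balancedMk V.ract P.lact v) (P.ract_mul p n n')) t
  equivariant := balancedRact_equivariant V.equivariant P.lact_equivariant P.ract P.lact_ract
    P.ract_equivariant

/-- The linear map `V ⊗_M P → W ⊗_M P` induced by a morphism `V ⟶ W`. -/
def tensorMap (P : BimoduleRep H M N) {V W : RightModRep H M} (f : V ⟶ W) :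
    BalancedTensor V.ract P.lact →ₗ[ℂ] BalancedTensor W.ract P.lact :=
  balancedLift (balancedMk W.ract P.lact ∘ₗ RightModRep.toLin f) fun v m p =>
    (congrArg (fun z => balancedMk W.ract P.lact z p) (RightModRep.toLin_ract f v m)).trans
      (balancedMk_ract (RightModRep.toLin f v) m p)

/-- The functor `V ↦ V ⊗_M P`. -/
def tensorFunctor (P : BimoduleRep H M N) : RightModRep H M ⥤ RightModRep H N where
  obj := P.tensor
  map {V W} f := RightModRep.mkHom (V := P.tensor V) (W := P.tensor W) (P.tensorMap f)
    (fun h => Submodule.linearMap_qext _ (LinearMap.ext fun t => by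
      have h1 := LinearMap.congr_fun (tensorRep_map (Bialgebra.comulAlgHom ℂ H) V.ρ P.ρ
        W.ρ P.ρ (RightModRep.toLin f) LinearMap.id (fun h => f.2.1 h) (fun _ => rfl) h) t
      have h2 : ∀ s, P.tensorMap f ((balancedRelations V.ract P.lact).mkQ s) =
          (balancedRelations W.ract P.lact).mkQ
            (TensorProduct.map (RightModRep.toLin f) LinearMap.id s) := fun s =>
        LinearMap.congr_fun (f := P.tensorMap f ∘ₗ (balancedRelations V.ract P.lact).mkQ)
          (g := (balancedRelations W.ract P.lact).mkQ ∘ₗ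
            (TensorProduct.map (RightModRep.toLin f) LinearMap.id))
          (TensorProduct.ext' fun _ _ => rfl) s
      refine (h2 _).trans ?_
      refine Eq.trans ?_ (congrArg ((P.tensor W).ρ h) (h2 t).symm)
      exact congrArg (balancedRelations W.ract P.lact).mkQ h1))
    (fun t n => LinearMap.congr_fun
      (f := P.tensorMap f ∘ₗ (balancedRact V.ract P.ract P.lact_ract).flip n)
      (g := (balancedRact W.ract P.ract P.lact_ract).flip n ∘ₗ P.tensorMap f)
      (balanced_hom_ext fun _ _ => rfl) t)
  map_id _ := RightModRep.hom_ext (balanced_hom_ext fun _ _ => rfl)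
  map_comp _ _ := RightModRep.hom_ext (balanced_hom_ext fun _ _ => rfl)

instance (P : BimoduleRep H M N) : P.tensorFunctor.Additive where
  map_add {_ W f g} := RightModRep.hom_ext (balanced_hom_ext fun v p =>
    LinearMap.congr_fun (map_add (balancedMk W.ract P.lact) (RightModRep.toLin f v)
      (RightModRep.toLin g v)) p)

instance (P : BimoduleRep H M N) : P.tensorFunctor.Linear ℂ where
  map_smul {_ W} f c := RightModRep.hom_ext (balanced_hom_ext fun v p =>
    LinearMap.congr_fun (map_smul (balancedMk W.ract P.lact) c (RightModRep.toLin f v)) p)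

/-- The linear map `(X ⊗ V) ⊗_M P → X ⊗ (V ⊗_M P)`. -/
def tensorδLin (P : BimoduleRep H M N) (X : FDMod H) (V : RightModRep H M) :
    BalancedTensor (tensorRact X.carrier V.ract) P.lact →ₗ[ℂ]
      X.carrier ⊗[ℂ] BalancedTensor V.ract P.lact :=
  (balancedRelations (tensorRact X.carrier V.ract) P.lact).liftQ
    (TensorProduct.map LinearMap.id (balancedRelations V.ract P.lact).mkQ ∘ₗ
      (TensorProduct.assoc ℂ X.carrier V.carrier P.carrier).toLinearMap) (by
    refine Submodule.span_le.2 ?_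
    rintro _ ⟨t, m, p, rfl⟩
    refine LinearMap.mem_ker.2 ((map_sub _ _ _).trans (sub_eq_zero.2 ?_))
    induction t with
    | zero => simp
    | add t t' ht ht' => simp only [map_add, LinearMap.add_apply, TensorProduct.add_tmul, ht, ht']
    | tmul x v => exact congrArg (x ⊗ₜ[ℂ] ·) (balancedMk_ract v m p))

/-- The morphism `(X ⊗ V) ⊗_M P ⟶ X ⊗ (V ⊗_M P)`. -/
def tensorδ (P : BimoduleRep H M N) (X : FDMod H) (V : RightModRep H M) :
    P.tensorFunctor.obj (X ⊙ₗ V) ⟶ X ⊙ₗ P.tensorFunctor.obj V :=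
  RightModRep.mkHom (V := P.tensor (RightModRep.tensor X V))
    (W := RightModRep.tensor X (P.tensor V)) (P.tensorδLin X V)
    (fun h => Submodule.linearMap_qext _ (LinearMap.ext fun t => by
      have h1 := LinearMap.congr_fun (tensorRep_assoc (Bialgebra.comulAlgHom ℂ H) comul_coassoc'
        X.ρ V.ρ P.ρ h) t
      have h2 := LinearMap.congr_fun (tensorRep_map (Bialgebra.comulAlgHom ℂ H) X.ρ
        (tensorRepH V.ρ P.ρ) X.ρ (balancedRep V.equivariant P.lact_equivariant) LinearMap.id
        (balancedRelations V.ract P.lact).mkQ (fun _ => rfl)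
        (mkQ_comp_tensorRep V.equivariant P.lact_equivariant) h)
        (TensorProduct.assoc ℂ X.carrier V.carrier P.carrier t)
      refine Eq.trans ?_ h2
      exact congrArg (TensorProduct.map LinearMap.id (balancedRelations V.ract P.lact).mkQ) h1))
    (fun t n => LinearMap.congr_fun
      (f := P.tensorδLin X V ∘ₗ
        (balancedRact (tensorRact X.carrier V.ract) P.ract P.lact_ract).flip n)
      (g := (tensorRact X.carrier (balancedRact V.ract P.ract P.lact_ract)).flip n ∘ₗ
        P.tensorδLin X V)
      (Submodule.linearMap_qext _ (TensorProduct.ext_threefold fun _ _ _ => rfl)) t)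

/-- Every structure map is a rebracketing, so coherence can be read off on pure tensors of `X ⊗ V ⊗
P`. -/
instance tensorOplaxLeftLinear (P : BimoduleRep H M N) :
    P.tensorFunctor.OplaxLeftLinear (FDMod H) where
  δₗ X V := P.tensorδ X V
  δₗ_naturality_left _ _ := RightModRep.hom_ext (Submodule.linearMap_qext _
    (TensorProduct.ext_threefold fun _ _ _ => rfl))
  δₗ_naturality_right _ _ _ _ := RightModRep.hom_ext (Submodule.linearMap_qext _
    (TensorProduct.ext_threefold fun _ _ _ => rfl))
  δₗ_associativity _ _ _ := RightModRep.hom_ext (Submodule.linearMap_qext _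
    (TensorProduct.ext_fourfold fun _ _ _ _ => rfl))
  δₗ_unitality_inv V := unitality_inv_of_hom P.tensorFunctor (P.tensorδ (𝟙_ (FDMod H)) V)
    (RightModRep.hom_ext (Submodule.linearMap_qext _ (TensorProduct.ext_threefold fun c v p =>
      (LinearMap.congr_fun (map_smul (balancedMk V.ract P.lact) c.down v) p).symm)))

end BimoduleRep

end BimoduleTensor

/-! ### Part (2): equivariant Morita equivalence implies equivalence of module categories -/

section BimoduleMorita

open MonoidalLeftAction

variable {H M N : Type u} [Ring H] [Bialgebra ℂ H]
  [Ring M] [Algebra ℂ M] [ModuleAlgebra H M] [Ring N] [Algebra ℂ N] [ModuleAlgebra H N]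

namespace BimoduleRep

variable (P : BimoduleRep H M N) (Q : BimoduleRep H N M)
  (e : BalancedTensor P.ract Q.lact ≃ₗ[ℂ] M) (V : RightModRep H M)

/-- The bilinear map `(v ⊗ p, q) ↦ v e(p ⊗ q)`. -/
def evalBilin (hl : ∀ m p q, e (balancedMk P.ract Q.lact (P.lact m p) q) =
      m * e (balancedMk P.ract Q.lact p q)) :
    BalancedTensor V.ract P.lact →ₗ[ℂ] Q.carrier →ₗ[ℂ] V.carrier :=
  balancedLift
    { toFun v := (balancedMk P.ract Q.lact).compr₂ (V.ract v ∘ₗ e.toLinearMap)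
      map_add' v v' := by ext; simp
      map_smul' c v := by ext; simp }
    fun v m p => LinearMap.ext fun q => by simp [hl, V.ract_mul]

/-- The bilinear map `(v, p ⊗ q) ↦ (v ⊗ p) ⊗ q`. -/
def assocBilin :
    V.carrier →ₗ[ℂ] BalancedTensor P.ract Q.lact →ₗ[ℂ]
      BalancedTensor (P.tensor V).ract Q.lact :=
  balancedLift₂ ((balancedMk V.ract P.lact).compr₂
      (balancedMk (balancedRact V.ract P.ract P.lact_ract) Q.lact))
    fun v p n q => balancedMk_ract (ract := balancedRact V.ract P.ract P.lact_ract)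
      (balancedMk V.ract P.lact v p) n q

variable {P Q e V}

theorem assocBilin_mk (v : V.carrier) (p : P.carrier) (q : Q.carrier) :
    assocBilin P Q V v (balancedMk P.ract Q.lact p q) =
      balancedMk (P.tensor V).ract Q.lact (balancedMk V.ract P.lact v p) q :=
  rfl

/-- Left `M`-linearity of `e`, read for `e.symm`; at `x = e(p ⊗ q)`, `1` and `v` it shows that `v ↦
v ⊗ e⁻¹(1)` inverts the evaluation. -/
theorem assocBilin_symm (hl : ∀ m p q, e (balancedMk P.ract Q.lact (P.lact m p) q) =
      m * e (balancedMk P.ract Q.lact p q)) (x m : M) (v : V.carrier) :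
    assocBilin P Q V (V.ract v m) (e.symm x) = assocBilin P Q V v (e.symm (m * x)) := by
  obtain ⟨t, rfl⟩ := e.surjective x
  rw [e.symm_apply_apply]
  induction t using balanced_induction with
  | zero => simp
  | add s t hs ht => simp only [map_add, hs, ht, mul_add]
  | mk p q =>
    rw [← hl, e.symm_apply_apply, assocBilin_mk, assocBilin_mk]
    exact congrArg (fun z => balancedMk (P.tensor V).ract Q.lact z q) (balancedMk_ract v m p)

theorem evalBilin_ract (hl : ∀ m p q, e (balancedMk P.ract Q.lact (P.lact m p) q) =
      m * e (balancedMk P.ract Q.lact p q)) (t : BalancedTensor V.ract P.lact) (n : N)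
    (q : Q.carrier) :
    evalBilin P Q e V hl ((P.tensor V).ract t n) q = evalBilin P Q e V hl t (Q.lact n q) :=
  LinearMap.congr_fun
    (f := (evalBilin P Q e V hl).flip q ∘ₗ (balancedRact V.ract P.ract P.lact_ract).flip n)
    (g := (evalBilin P Q e V hl).flip (Q.lact n q))
    (balanced_hom_ext fun v p => congrArg (fun z => V.ract v (e z)) (balancedMk_ract p n q)) t

/-- The map `(V ⊗_M P) ⊗_N Q → V`, `(v ⊗ p) ⊗ q ↦ v e(p ⊗ q)`. -/
def evalMap (hl : ∀ m p q, e (balancedMk P.ract Q.lact (P.lact m p) q) =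
      m * e (balancedMk P.ract Q.lact p q)) :
    BalancedTensor (P.tensor V).ract Q.lact →ₗ[ℂ] V.carrier :=
  balancedLift (ract := (P.tensor V).ract) (evalBilin P Q e V hl) (evalBilin_ract hl)

theorem evalMap_assocBilin (hl : ∀ m p q, e (balancedMk P.ract Q.lact (P.lact m p) q) =
      m * e (balancedMk P.ract Q.lact p q)) (t : BalancedTensor P.ract Q.lact) (v : V.carrier) :
    evalMap hl (assocBilin P Q V v t) = V.ract v (e t) := by
  induction t using balanced_induction with
  | zero => simp
  | add s t hs ht => simp only [map_add, hs, ht]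
  | mk p q => rfl

/-- The isomorphism `(V ⊗_M P) ⊗_N Q ≅ V`, `(v ⊗ p) ⊗ q ↦ v e(p ⊗ q)`. -/
def evalEquiv (hl : ∀ m p q, e (balancedMk P.ract Q.lact (P.lact m p) q) =
      m * e (balancedMk P.ract Q.lact p q)) :
    BalancedTensor (P.tensor V).ract Q.lact ≃ₗ[ℂ] V.carrier :=
  LinearEquiv.ofLinearMap (evalMap hl) ((assocBilin P Q V).flip (e.symm 1))
    (LinearMap.ext fun v => by
      simpa [V.ract_one] using evalMap_assocBilin hl (e.symm 1) v)
    (balanced_hom_ext fun t q => by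
      refine LinearMap.congr_fun
        (f := (assocBilin P Q V).flip (e.symm 1) ∘ₗ (evalBilin P Q e V hl).flip q)
        (g := (balancedMk (P.tensor V).ract Q.lact).flip q) (balanced_hom_ext fun v p => ?_) t
      -- In `v e(p ⊗ q) ⊗ e⁻¹(1)` the scalar is absorbed, leaving `v ⊗ e⁻¹(e(p ⊗ q)) = (v ⊗ p) ⊗ q`.
      have h := assocBilin_symm hl 1 (e (balancedMk P.ract Q.lact p q)) v
      rw [mul_one, e.symm_apply_apply] at h
      exact h)

/-- Lifted to `V ⊗ P ⊗ Q`, the evaluation is the associator, then `e` on the last two factors, then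
the action `V ⊗ M → V`; each of the three is `H`-linear. -/
theorem evalMap_equivariant (hl : ∀ m p q, e (balancedMk P.ract Q.lact (P.lact m p) q) =
      m * e (balancedMk P.ract Q.lact p q))
    (hh : ∀ h p q, ModuleAlgebra.act h (e (balancedMk P.ract Q.lact p q)) =
      e ((balancedRelations P.ract Q.lact).mkQ
        (tensorRep (Bialgebra.comulAlgHom ℂ H) P.ρ Q.ρ h (p ⊗ₜ[ℂ] q)))) (h : H) :
    evalMap (V := V) hl ∘ₗ (Q.tensor (P.tensor V)).ρ h = V.ρ h ∘ₗ evalMap hl := by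
  let E : P.carrier ⊗[ℂ] Q.carrier →ₗ[ℂ] M :=
    e.toLinearMap ∘ₗ (balancedRelations P.ract Q.lact).mkQ
  have hE : ∀ h, E ∘ₗ tensorRepH P.ρ Q.ρ h = ModuleAlgebra.act h ∘ₗ E := fun h =>
    TensorProduct.ext' fun p q => (hh h p q).symm
  have key : ∀ s : (V.carrier ⊗[ℂ] P.carrier) ⊗[ℂ] Q.carrier,
      evalMap hl ((balancedRelations (P.tensor V).ract Q.lact).mkQ
        (TensorProduct.map (balancedRelations V.ract P.lact).mkQ LinearMap.id s)) =
      TensorProduct.lift V.ract (TensorProduct.map LinearMap.id E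
        (TensorProduct.assoc ℂ V.carrier P.carrier Q.carrier s)) := fun s =>
    LinearMap.congr_fun (f := evalMap hl ∘ₗ (balancedRelations (P.tensor V).ract Q.lact).mkQ ∘ₗ
        TensorProduct.map (balancedRelations V.ract P.lact).mkQ LinearMap.id)
      (g := TensorProduct.lift V.ract ∘ₗ TensorProduct.map LinearMap.id E ∘ₗ
        (TensorProduct.assoc ℂ V.carrier P.carrier Q.carrier).toLinearMap)
      (TensorProduct.ext_threefold fun _ _ _ => rfl) s
  refine Submodule.linearMap_qext _ (LinearMap.ext fun t => ?_)
  obtain ⟨s, rfl⟩ := TensorProduct.map_surjective (balancedRelations V.ract P.lact).mkQ_surjective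
    (Function.surjective_id (α := Q.carrier)) (g' := LinearMap.id) t
  have h1 := LinearMap.congr_fun (tensorRep_map (Bialgebra.comulAlgHom ℂ H) (tensorRepH V.ρ P.ρ)
    Q.ρ (P.tensor V).ρ Q.ρ (balancedRelations V.ract P.lact).mkQ LinearMap.id
    (mkQ_comp_tensorRep V.equivariant P.lact_equivariant) (fun _ => rfl) h) s
  have h2 := LinearMap.congr_fun (tensorRep_assoc (Bialgebra.comulAlgHom ℂ H) comul_coassoc'
    V.ρ P.ρ Q.ρ h) s
  have h3 := LinearMap.congr_fun (tensorRep_map (Bialgebra.comulAlgHom ℂ H) V.ρ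
    (tensorRepH P.ρ Q.ρ) V.ρ ModuleAlgebra.act LinearMap.id E (fun _ => rfl) hE h)
    (TensorProduct.assoc ℂ V.carrier P.carrier Q.carrier s)
  have h4 := LinearMap.congr_fun (V.equivariant h) (TensorProduct.map LinearMap.id E
    (TensorProduct.assoc ℂ V.carrier P.carrier Q.carrier s))
  refine (congrArg (fun z => evalMap hl ((balancedRelations (P.tensor V).ract Q.lact).mkQ z))
    h1.symm).trans ?_
  refine (key _).trans ?_
  refine Eq.trans ?_ (congrArg (V.ρ h) (key s).symm)
  refine Eq.trans ?_ h4.symm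
  refine congrArg (TensorProduct.lift V.ract) ?_
  exact (congrArg (TensorProduct.map LinearMap.id E) h2).trans h3

theorem evalMap_ract (hl : ∀ m p q, e (balancedMk P.ract Q.lact (P.lact m p) q) =
      m * e (balancedMk P.ract Q.lact p q))
    (hr : ∀ p q m, e (balancedMk P.ract Q.lact p (Q.ract q m)) =
      e (balancedMk P.ract Q.lact p q) * m) (t : BalancedTensor (P.tensor V).ract Q.lact) (m : M) :
    evalMap hl ((Q.tensor (P.tensor V)).ract t m) = V.ract (evalMap hl t) m := by
  have key : ∀ s q, evalBilin P Q e V hl s (Q.ract q m) =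
      V.ract (evalBilin P Q e V hl s q) m := fun s q =>
    LinearMap.congr_fun (f := (evalBilin P Q e V hl).flip (Q.ract q m))
      (g := V.ract.flip m ∘ₗ (evalBilin P Q e V hl).flip q) (balanced_hom_ext fun v p => by
        change V.ract v (e (balancedMk P.ract Q.lact p (Q.ract q m))) =
          V.ract (V.ract v (e (balancedMk P.ract Q.lact p q))) m
        rw [hr, V.ract_mul]) s
  exact LinearMap.congr_fun
    (f := evalMap hl ∘ₗ (balancedRact (P.tensor V).ract Q.ract Q.lact_ract).flip m)
    (g := V.ract.flip m ∘ₗ evalMap hl) (balanced_hom_ext key) t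

/-- The natural isomorphism `(V ⊗_M P) ⊗_N Q ≅ V` induced by `P ⊗_N Q ≅ M`. -/
def evalIso (hl : ∀ m p q, e (balancedMk P.ract Q.lact (P.lact m p) q) =
      m * e (balancedMk P.ract Q.lact p q))
    (hr : ∀ p q m, e (balancedMk P.ract Q.lact p (Q.ract q m)) =
      e (balancedMk P.ract Q.lact p q) * m)
    (hh : ∀ h p q, ModuleAlgebra.act h (e (balancedMk P.ract Q.lact p q)) =
      e ((balancedRelations P.ract Q.lact).mkQ
        (tensorRep (Bialgebra.comulAlgHom ℂ H) P.ρ Q.ρ h (p ⊗ₜ[ℂ] q)))) :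
    P.tensorFunctor ⋙ Q.tensorFunctor ≅ 𝟭 (RightModRep H M) :=
  NatIso.ofComponents
    (fun V => RightModRep.mkIso (V := Q.tensor (P.tensor V)) (W := V) (evalEquiv hl)
      (evalMap_equivariant hl hh) (evalMap_ract hl hr))
    (fun {V W} f => RightModRep.hom_ext (balanced_hom_ext fun t q =>
      LinearMap.congr_fun
        (f := (evalBilin P Q e W hl).flip q ∘ₗ P.tensorMap f)
        (g := RightModRep.toLin f ∘ₗ (evalBilin P Q e V hl).flip q) (balanced_hom_ext fun v p =>
          (RightModRep.toLin_ract f v (e (balancedMk P.ract Q.lact p q))).symm) t))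

theorem tensorδ_evalIso (hl : ∀ m p q, e (balancedMk P.ract Q.lact (P.lact m p) q) =
      m * e (balancedMk P.ract Q.lact p q))
    (hr : ∀ p q m, e (balancedMk P.ract Q.lact p (Q.ract q m)) =
      e (balancedMk P.ract Q.lact p q) * m)
    (hh : ∀ h p q, ModuleAlgebra.act h (e (balancedMk P.ract Q.lact p q)) =
      e ((balancedRelations P.ract Q.lact).mkQ
        (tensorRep (Bialgebra.comulAlgHom ℂ H) P.ρ Q.ρ h (p ⊗ₜ[ℂ] q))))
    (X : FDMod H) (V : RightModRep H M) :
    Q.tensorFunctor.map (P.tensorδ X V) ≫ Q.tensorδ X (P.tensorFunctor.obj V) ≫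
        X ⊴ₗ (evalIso hl hr hh).hom.app V =
      (evalIso hl hr hh).hom.app (X ⊙ₗ V) :=
  RightModRep.hom_ext (balanced_hom_ext fun t q =>
    LinearMap.congr_fun
      (f := RightModRep.toLin (Q.tensorδ X (P.tensorFunctor.obj V) ≫
          X ⊴ₗ (evalIso hl hr hh).hom.app V) ∘ₗ
        (balancedMk (tensorRact X.carrier (P.tensor V).ract) Q.lact).flip q ∘ₗ P.tensorδLin X V)
      (g := (evalBilin P Q e (X ⊙ₗ V) hl).flip q)
      (Submodule.linearMap_qext _ (TensorProduct.ext_threefold fun _ _ _ => rfl)) t)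

end BimoduleRep

theorem ModuleAlgebra.EquivariantlyMoritaEquivalent.topologicallyEquivalent
    (h : ModuleAlgebra.EquivariantlyMoritaEquivalent H M N) :
    ModuleAlgebra.TopologicallyEquivalent H M N := by
  obtain ⟨P, Q, ⟨e, hl, hr, hh⟩, ⟨e', hl', hr', hh'⟩⟩ := h
  have hα := BimoduleRep.tensorδ_evalIso hl hr hh
  have hβ := BimoduleRep.tensorδ_evalIso hl' hr' hh'
  exact ⟨P.tensorFunctor,
    (CategoryTheory.Equivalence.mk P.tensorFunctor Q.tensorFunctor
      (BimoduleRep.evalIso hl hr hh).symm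
      (BimoduleRep.evalIso hl' hr' hh')).isEquivalence_functor,
    inferInstance, inferInstance, ⟨leftLinearOfOplax _ (isIso_δₗ_of_comp
      (BimoduleRep.evalIso hl hr hh) (BimoduleRep.evalIso hl' hr' hh') hα hβ)⟩⟩

end BimoduleMorita

/-! ### Part (2): equivalence of module categories implies equivariant Morita equivalence -/

section ModuleConverse

open MonoidalLeftAction CategoryTheory.Functor.OplaxLeftLinear CategoryTheory.Functor.LaxLeftLinear

variable {H M N : Type u} [Ring H] [Bialgebra ℂ H]
  [Ring M] [Algebra ℂ M] [ModuleAlgebra H M] [Ring N] [Algebra ℂ N] [ModuleAlgebra H N]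

theorem lift_curry {X Y Z : Type*} [AddCommGroup X] [Module ℂ X] [AddCommGroup Y] [Module ℂ Y]
    [AddCommGroup Z] [Module ℂ Z] (f : X ⊗[ℂ] Y →ₗ[ℂ] Z) :
    TensorProduct.lift (TensorProduct.curry f) = f :=
  TensorProduct.ext' fun _ _ => rfl

namespace RightModRep

theorem epi_of_surjective {V W : RightModRep H M} (f : V ⟶ W)
    (hf : Function.Surjective (toLin f)) : Epi f where
  left_cancellation g h hgh := hom_ext (LinearMap.ext fun w => by
    obtain ⟨v, rfl⟩ := hf w
    exact congr_toLin hgh v)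

/-- The `H`-linear map underlying a morphism of modules in `Rep(H)`. -/
def forgetHom {V W : RightModRep H M} (f : V ⟶ W) : V.toFDMod ⟶ W.toFDMod :=
  FDMod.mkHom (toLin f) f.2.1

/-- The action `V ⊗ M ⟶ V` as a morphism in `Rep(H)`. -/
def ractHom [FiniteDimensional ℂ M] (V : RightModRep H M) :
    V.toFDMod ⊗ (⟨M, ModuleAlgebra.act⟩ : FDMod H) ⟶ V.toFDMod :=
  FDMod.mkHom (V := V.toFDMod ⊗ (⟨M, ModuleAlgebra.act⟩ : FDMod H)) (TensorProduct.lift V.ract)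
    fun h => (V.equivariant h).symm

variable [FiniteDimensional ℂ M]

variable (H M) in
/-- The algebra `M` as a right module over itself. -/
abbrev regular : RightModRep H M where
  carrier := M
  ρ := ModuleAlgebra.act
  ract := LinearMap.mul ℂ M
  ract_one := mul_one
  ract_mul v m m' := (mul_assoc v m m').symm
  equivariant := ModuleAlgebra.act_mul

variable (H M) in
/-- The unit of `M` as a morphism in `Rep(H)`. -/
def unitHom : 𝟙_ (FDMod H) ⟶ (regular H M).toFDMod :=
  FDMod.mkHom (V := 𝟙_ (FDMod H)) (W := (regular H M).toFDMod)
    (LinearMap.toSpanSingleton ℂ M 1 ∘ₗ ULift.moduleEquiv.toLinearMap) fun h =>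
    LinearMap.ext fun c => by
      change ((Coalgebra.counit h : ℂ) * c.down) • (1 : M) =
        ModuleAlgebra.act (M := M) h (c.down • (1 : M))
      rw [map_smul, ModuleAlgebra.act_one, smul_smul, mul_comm]

/-- The morphism `V ⟶ V ⊗ M`, `v ↦ v ⊗ 1`, in `Rep(H)`. -/
def insertOne (V : RightModRep H M) : V.toFDMod ⟶ V.toFDMod ⊗ (regular H M).toFDMod :=
  (ρ_ V.toFDMod).inv ≫ V.toFDMod ◁ unitHom H M

theorem insertOne_apply (V : RightModRep H M) (v : V.carrier) :
    FDMod.toLin (insertOne V) v = v ⊗ₜ[ℂ] (1 : M) := by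
  change v ⊗ₜ[ℂ] ((1 : ℂ) • (1 : M)) = _
  rw [one_smul]

/-- The action `V ⊗ M ⟶ V` as a morphism of right `M`-modules in `Rep(H)`. -/
def actionHom (V : RightModRep H M) : V.toFDMod ⊙ₗ regular H M ⟶ V :=
  RightModRep.mkHom (V := V.toFDMod ⊙ₗ regular H M) (TensorProduct.lift V.ract)
    (fun h => (V.equivariant h).symm) fun t m =>
    LinearMap.congr_fun
      (f := TensorProduct.lift V.ract ∘ₗ (tensorRact V.carrier (LinearMap.mul ℂ M)).flip m)
      (g := V.ract.flip m ∘ₗ TensorProduct.lift V.ract)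
      (TensorProduct.ext' fun v m' => V.ract_mul v m' m) t

theorem ractHom_comp_actionHom (V : RightModRep H M) :
    V.ractHom ⊵ₗ regular H M ≫ V.actionHom =
      (αₗ V.toFDMod (regular H M).toFDMod (regular H M)).hom ≫
        V.toFDMod ⊴ₗ (regular H M).actionHom ≫ V.actionHom :=
  hom_ext (TensorProduct.ext_threefold fun v m m' => (V.ract_mul v m m').symm)

theorem unitHom_comp_actionHom :
    (λₗ (regular H M)).inv ≫ unitHom H M ⊵ₗ regular H M ≫ (regular H M).actionHom = 𝟙 _ :=
  hom_ext (LinearMap.ext fun m => by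
    change ((1 : ℂ) • (1 : M)) * m = m
    rw [one_smul, one_mul])

theorem forgetHom_comp_actionHom {V W : RightModRep H M} (f : V ⟶ W) :
    forgetHom f ⊵ₗ regular H M ≫ W.actionHom = V.actionHom ≫ f :=
  hom_ext (TensorProduct.ext' fun v m => (toLin_ract f v m).symm)

theorem actionHom_tensor (X : FDMod H) (V : RightModRep H M) :
    (X ⊙ₗ V).actionHom = (αₗ X V.toFDMod (regular H M)).hom ≫ X ⊴ₗ V.actionHom :=
  hom_ext (TensorProduct.ext_threefold fun _ _ _ => rfl)

instance (V : RightModRep H M) : Epi V.actionHom :=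
  epi_of_surjective _ fun v => ⟨v ⊗ₜ[ℂ] (1 : M), V.ract_one v⟩

variable (F : RightModRep H M ⥤ RightModRep H N) [F.LeftLinear (FDMod H)]

/-- The morphism `V ⊗ F(M) ⟶ F(V ⊗ M) ⟶ F(V)`. -/
def functorAction (V : RightModRep H M) : V.toFDMod ⊙ₗ F.obj (regular H M) ⟶ F.obj V :=
  μₗ F V.toFDMod (regular H M) ≫ F.map V.actionHom

/-- Associativity of the action of `M` on `V`, transported by `F` and the coherence of `μₗ`. For `V
= M` it is associativity of the left action on `F(M)`; for general `V` it is the balancing of `V ⊗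
F(M) → F(V)`. -/
theorem ractHom_comp_functorAction (V : RightModRep H M) :
    V.ractHom ⊵ₗ F.obj (regular H M) ≫ functorAction F V =
      (αₗ V.toFDMod (regular H M).toFDMod (F.obj (regular H M))).hom ≫
        V.toFDMod ⊴ₗ functorAction F (regular H M) ≫ functorAction F V := by
  have h := μₗ_naturality_left F V.ractHom (regular H M)
  rw [functorAction, functorAction, actionHomRight_comp, Category.assoc,
    μₗ_naturality_right_assoc]
  refine (Category.assoc _ _ _).symm.trans ((congrArg (· ≫ F.map V.actionHom) h).trans ?_)
  refine (Category.assoc _ _ _).trans ?_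
  rw [← F.map_comp, ractHom_comp_actionHom, F.map_comp, F.map_comp, μₗ_associativity_assoc]

theorem unitHom_comp_functorAction :
    (λₗ (F.obj (regular H M))).inv ≫ unitHom H M ⊵ₗ F.obj (regular H M) ≫
      functorAction F (regular H M) = 𝟙 _ := by
  rw [functorAction, μₗ_naturality_left_assoc, μₗ_unitality_inv_assoc, ← F.map_comp, ← F.map_comp,
    unitHom_comp_actionHom, F.map_id]

theorem forgetHom_comp_functorAction {V W : RightModRep H M} (f : V ⟶ W) :
    forgetHom f ⊵ₗ F.obj (regular H M) ≫ functorAction F W = functorAction F V ≫ F.map f := by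
  rw [functorAction, functorAction, μₗ_naturality_left_assoc, ← F.map_comp,
    forgetHom_comp_actionHom, F.map_comp, Category.assoc]

theorem functorAction_tensor (X : FDMod H) (V : RightModRep H M) :
    functorAction F (X ⊙ₗ V) = (αₗ X V.toFDMod (F.obj (regular H M))).hom ≫
      X ⊴ₗ functorAction F V ≫ μₗ F X V := by
  have h : μₗ F (X ⊗ V.toFDMod) (regular H M) ≫
        F.map ((αₗ X V.toFDMod (regular H M)).hom ≫ X ⊴ₗ V.actionHom) =
      (αₗ X V.toFDMod (F.obj (regular H M))).hom ≫ X ⊴ₗ functorAction F V ≫ μₗ F X V := by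
    rw [functorAction, F.map_comp, actionHomRight_comp, Category.assoc, μₗ_naturality_right,
      μₗ_associativity_assoc]
  exact (congrArg (fun f => μₗ F (X ⊗ V.toFDMod) (regular H M) ≫ F.map f)
    (actionHom_tensor X V)).trans h

end RightModRep

open RightModRep

variable [FiniteDimensional ℂ M]

namespace BimoduleRep

section

variable (F : RightModRep H M ⥤ RightModRep H N) [F.LeftLinear (FDMod H)]

/-- The bimodule `F(M)` in `Rep(H)` determined by a module functor `F`. -/
def ofFunctor : BimoduleRep H M N where
  toFDMod := (F.obj (regular H M)).toFDMod
  lact := TensorProduct.curry (toLin (functorAction F (regular H M)))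
  one_lact p := by
    refine Eq.trans ?_ (RightModRep.congr_toLin (unitHom_comp_functorAction F) p)
    change toLin (functorAction F (regular H M)) ((1 : M) ⊗ₜ p) =
      toLin (functorAction F (regular H M)) (((1 : ℂ) • (1 : M)) ⊗ₜ p)
    rw [one_smul]
  mul_lact m m' p := RightModRep.congr_toLin (ractHom_comp_functorAction F (regular H M))
    ((m ⊗ₜ[ℂ] m') ⊗ₜ[ℂ] p)
  ract := (F.obj (regular H M)).ract
  ract_one := (F.obj (regular H M)).ract_one
  ract_mul := (F.obj (regular H M)).ract_mul
  lact_ract m p n := toLin_ract (functorAction F (regular H M)) (m ⊗ₜ[ℂ] p) n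
  lact_equivariant h := TensorProduct.ext' fun m p =>
    (toLin_ρ (functorAction F (regular H M)) h (m ⊗ₜ[ℂ] p)).symm.trans
      (congrArg (fun f : M ⊗[ℂ] (F.obj (regular H M)).carrier →ₗ[ℂ] _ => f _)
        (lift_curry _).symm)
  ract_equivariant := (F.obj (regular H M)).equivariant

/-- The projection `V ⊗ F(M) ⟶ V ⊗_M F(M)`. -/
def balancedProj (V : RightModRep H M) :
    V.toFDMod ⊙ₗ F.obj (regular H M) ⟶ (ofFunctor F).tensor V :=
  RightModRep.mkHom (V := V.toFDMod ⊙ₗ F.obj (regular H M)) (W := (ofFunctor F).tensor V)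
    (balancedRelations V.ract (ofFunctor F).lact).mkQ
    (mkQ_comp_tensorRep V.equivariant (ofFunctor F).lact_equivariant) fun t n =>
    LinearMap.congr_fun
      (f := (balancedRelations V.ract (ofFunctor F).lact).mkQ ∘ₗ
        (tensorRact V.carrier (F.obj (regular H M)).ract).flip n)
      (g := ((ofFunctor F).tensor V).ract.flip n ∘ₗ
        (balancedRelations V.ract (ofFunctor F).lact).mkQ)
      (TensorProduct.ext' fun _ _ => rfl) t

instance (V : RightModRep H M) : Epi (balancedProj F V) :=
  RightModRep.epi_of_surjective _
    (balancedRelations V.ract (ofFunctor F).lact).mkQ_surjective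

theorem ractHom_comp_balancedProj (V : RightModRep H M) :
    V.ractHom ⊵ₗ F.obj (regular H M) ≫ balancedProj F V =
      (αₗ V.toFDMod (regular H M).toFDMod (F.obj (regular H M))).hom ≫
        V.toFDMod ⊴ₗ functorAction F (regular H M) ≫ balancedProj F V :=
  RightModRep.hom_ext (TensorProduct.ext_threefold fun v m p =>
    balancedMk_ract (ract := V.ract) (lact := (ofFunctor F).lact) v m p)

/-- The morphism `V ⊗_M F(M) ⟶ F(V)`. -/
def evalFunctorHom (V : RightModRep H M) : (ofFunctor F).tensor V ⟶ F.obj V :=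
  RightModRep.mkHom (V := (ofFunctor F).tensor V)
    (balancedLift (TensorProduct.curry (toLin (functorAction F V))) fun v m p =>
      RightModRep.congr_toLin (ractHom_comp_functorAction F V) ((v ⊗ₜ[ℂ] m) ⊗ₜ[ℂ] p))
    (fun h => Submodule.linearMap_qext _ (TensorProduct.ext' fun v p => by
      refine Eq.trans ?_ (toLin_ρ (functorAction F V) h (v ⊗ₜ[ℂ] p))
      exact congrArg (fun f : V.carrier ⊗[ℂ] (F.obj (regular H M)).carrier →ₗ[ℂ] _ => f _)
        (lift_curry _)))
    (fun t n => LinearMap.congr_fun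
      (f := balancedLift (TensorProduct.curry (toLin (functorAction F V))) (fun v m p =>
        RightModRep.congr_toLin (ractHom_comp_functorAction F V) ((v ⊗ₜ[ℂ] m) ⊗ₜ[ℂ] p)) ∘ₗ
          ((ofFunctor F).tensor V).ract.flip n)
      (g := (F.obj V).ract.flip n ∘ₗ
        balancedLift (TensorProduct.curry (toLin (functorAction F V))) (fun v m p =>
          RightModRep.congr_toLin (ractHom_comp_functorAction F V) ((v ⊗ₜ[ℂ] m) ⊗ₜ[ℂ] p)))
      (balanced_hom_ext fun v p => toLin_ract (functorAction F V) (v ⊗ₜ[ℂ] p) n) t)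

theorem balancedProj_comp_evalFunctorHom (V : RightModRep H M) :
    balancedProj F V ≫ evalFunctorHom F V = functorAction F V :=
  RightModRep.hom_ext (TensorProduct.ext' fun _ _ => rfl)

/-- `V` is the coequalizer of `V ⊗ M ⊗ M ⇉ V ⊗ M`. The projection to `V ⊗_M F(M)` is pulled back
through the equivalence to a map out of `V ⊗ M`, and there shown to factor through `V`. -/
theorem exists_lift_balancedProj [F.IsEquivalence] (V : RightModRep H M) :
    ∃ ψ : F.obj V ⟶ (ofFunctor F).tensor V,
      F.map V.actionHom ≫ ψ = δₗ F V.toFDMod (regular H M) ≫ balancedProj F V := by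
  set W := (ofFunctor F).tensor V with hW
  let i := F.objObjPreimageIso W
  let g : V.toFDMod ⊙ₗ regular H M ⟶ F.objPreimage W :=
    F.preimage (δₗ F V.toFDMod (regular H M) ≫ balancedProj F V ≫ i.inv)
  have hg : F.map g = δₗ F V.toFDMod (regular H M) ≫ balancedProj F V ≫ i.inv :=
    F.map_preimage _
  -- The two parallel maps `V ⊗ M ⊗ M ⇉ V ⊗ M` agree after `g`, because `F` and `δₗ` carry them to
  -- the two maps `V ⊗ M ⊗ F(M) ⇉ V ⊗ F(M)` whose difference is killed in `V ⊗_M F(M)`.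
  have key : V.ractHom ⊵ₗ regular H M ≫ g =
      (αₗ V.toFDMod (regular H M).toFDMod (regular H M)).hom ≫
        V.toFDMod ⊴ₗ (regular H M).actionHom ≫ g := by
    refine F.map_injective ?_
    have h1 := congrArg (· ≫ i.inv) (ractHom_comp_balancedProj F V)
    have h2 := δₗ_naturality_left F V.ractHom (regular H M)
    have h3 := δₗ_associativity F V.toFDMod (regular H M).toFDMod (regular H M)
    have h4 : F.map (αₗ V.toFDMod (regular H M).toFDMod (regular H M)).hom ≫
        δₗ F V.toFDMod ((regular H M).toFDMod ⊙ₗ regular H M) ≫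
          V.toFDMod ⊴ₗ F.map (regular H M).actionHom =
        δₗ F (V.toFDMod ⊗ (regular H M).toFDMod) (regular H M) ≫
          (αₗ V.toFDMod (regular H M).toFDMod (F.obj (regular H M))).hom ≫
            V.toFDMod ⊴ₗ functorAction F (regular H M) := by
      rw [← Category.assoc (δₗ _ _ _), h3, Category.assoc, Category.assoc, ← actionHomRight_comp,
        functorAction, CategoryTheory.Functor.LeftLinear.δₗ_comp_μₗ_assoc]
    have h5 : F.map (V.ractHom ⊵ₗ regular H M) ≫ F.map g =
        δₗ F (V.toFDMod ⊗ (regular H M).toFDMod) (regular H M) ≫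
          V.ractHom ⊵ₗ F.obj (regular H M) ≫ balancedProj F V ≫ i.inv := by
      rw [hg]
      exact (Category.assoc _ _ _).symm.trans
        ((congrArg (· ≫ balancedProj F V ≫ i.inv) h2).trans (Category.assoc _ _ _))
    have h6 : F.map (αₗ V.toFDMod (regular H M).toFDMod (regular H M)).hom ≫
        F.map (V.toFDMod ⊴ₗ (regular H M).actionHom) ≫ F.map g =
          δₗ F (V.toFDMod ⊗ (regular H M).toFDMod) (regular H M) ≫
            ((αₗ V.toFDMod (regular H M).toFDMod (F.obj (regular H M))).hom ≫
              V.toFDMod ⊴ₗ functorAction F (regular H M) ≫ balancedProj F V) ≫ i.inv := by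
      rw [hg, δₗ_naturality_right_assoc]
      simpa only [Category.assoc] using congrArg (· ≫ balancedProj F V ≫ i.inv) h4
    rw [F.map_comp, F.map_comp, F.map_comp]
    refine h5.trans (Eq.trans ?_ h6.symm)
    exact congrArg (δₗ F (V.toFDMod ⊗ (regular H M).toFDMod) (regular H M) ≫ ·)
      ((Category.assoc _ _ _).symm.trans h1)
  have key' : ∀ (v : V.carrier) (m : M), toLin g (v ⊗ₜ[ℂ] m) =
      toLin g (V.ract v m ⊗ₜ[ℂ] (1 : M)) := by
    intro v m
    refine Eq.trans ?_ (RightModRep.congr_toLin key ((v ⊗ₜ[ℂ] m) ⊗ₜ[ℂ] (1 : M))).symm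
    exact congrArg (fun z => toLin g (v ⊗ₜ[ℂ] z)) (mul_one m).symm
  let gbar : V ⟶ F.objPreimage W := RightModRep.mkHom
    (toLin g ∘ₗ (TensorProduct.mk ℂ V.carrier M).flip 1)
    (fun h => LinearMap.ext fun v => by
      refine Eq.trans ?_ (toLin_ρ g h (v ⊗ₜ[ℂ] (1 : M)))
      refine congrArg (toLin g) ?_
      -- The map `v ↦ v ⊗ 1` is `H`-linear because `h 1 = ε(h) 1` in `M`.
      refine (insertOne_apply V _).symm.trans ((FDMod.toLin_ρ (insertOne V) h v).trans ?_)
      exact congrArg ((V.toFDMod ⊗ (regular H M).toFDMod).ρ h) (insertOne_apply V v))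
    (fun v m => by
      refine (key' v m).symm.trans ?_
      refine Eq.trans ?_ (toLin_ract g (v ⊗ₜ[ℂ] (1 : M)) m)
      exact congrArg (fun z => toLin g (v ⊗ₜ[ℂ] z)) (one_mul m).symm)
  have hgbar : V.actionHom ≫ gbar = g :=
    RightModRep.hom_ext (TensorProduct.ext' fun v m => (key' v m).symm)
  refine ⟨F.map gbar ≫ i.hom, ?_⟩
  rw [← F.map_comp_assoc, hgbar, hg]
  simp

theorem isIso_evalFunctorHom [F.IsEquivalence] (V : RightModRep H M) :
    IsIso (evalFunctorHom F V) := by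
  obtain ⟨ψ, hψ⟩ := exists_lift_balancedProj F V
  have h1 := balancedProj_comp_evalFunctorHom F V
  have h2 : functorAction F V ≫ ψ = balancedProj F V := by
    rw [functorAction, Category.assoc, hψ]; simp
  refine ⟨ψ, ?_, ?_⟩
  · rw [← cancel_epi (balancedProj F V), ← Category.assoc, h1, h2, Category.comp_id]
  · have : Epi (functorAction F V) := by unfold functorAction; infer_instance
    rw [← cancel_epi (functorAction F V), Category.comp_id, ← Category.assoc, h2, h1]

end

variable [FiniteDimensional ℂ N] {F : RightModRep H M ⥤ RightModRep H N}
  [F.LeftLinear (FDMod H)] {G : RightModRep H N ⥤ RightModRep H M} [G.LeftLinear (FDMod H)]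

/-- This is left `M`-linearity of `F(M) ⊗_N G(N) → G(F(M)) ≅ M`. The left action on `F(M)` is itself
an `N`-linear map, so naturality of the `G`-action applies to it; `hα` then turns the resulting
structure map of `G` into the multiplication of `M`. -/
theorem functorAction_comp (α : F ⋙ G ≅ 𝟭 (RightModRep H M))
    (hα : ∀ (X : FDMod H) V, G.map (μₗ F X V) ≫ α.hom.app (X ⊙ₗ V) =
      δₗ G X (F.obj V) ≫ X ⊴ₗ α.hom.app V) :
    forgetHom (functorAction F (regular H M)) ⊵ₗ G.obj (regular H N) ≫
        functorAction G (F.obj (regular H M)) ≫ α.hom.app (regular H M) =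
      (αₗ (regular H M).toFDMod (F.obj (regular H M)).toFDMod (G.obj (regular H N))).hom ≫
        (regular H M).toFDMod ⊴ₗ (functorAction G (F.obj (regular H M)) ≫
          α.hom.app (regular H M)) ≫ (regular H M).actionHom := by
  have h1 := forgetHom_comp_functorAction G (functorAction F (regular H M))
  have h2 : G.map (F.map (regular H M).actionHom) ≫ α.hom.app (regular H M) =
      α.hom.app _ ≫ (regular H M).actionHom := α.hom.naturality _
  have h3 : G.map (functorAction F (regular H M)) ≫ α.hom.app (regular H M) =
      δₗ G (regular H M).toFDMod (F.obj (regular H M)) ≫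
        (regular H M).toFDMod ⊴ₗ α.hom.app (regular H M) ≫ (regular H M).actionHom := by
    rw [functorAction, G.map_comp, Category.assoc, h2, ← Category.assoc, hα, Category.assoc]
  have h4 : ((αₗ (regular H M).toFDMod (F.obj (regular H M)).toFDMod (G.obj (regular H N))).hom ≫
        (regular H M).toFDMod ⊴ₗ functorAction G (F.obj (regular H M)) ≫
          μₗ G (regular H M).toFDMod (F.obj (regular H M))) ≫
        G.map (functorAction F (regular H M)) ≫ α.hom.app (regular H M) =
      (αₗ (regular H M).toFDMod (F.obj (regular H M)).toFDMod (G.obj (regular H N))).hom ≫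
        (regular H M).toFDMod ⊴ₗ (functorAction G (F.obj (regular H M)) ≫
          α.hom.app (regular H M)) ≫ (regular H M).actionHom := by
    rw [h3]
    simp
  refine (Category.assoc _ _ _).symm.trans ((congrArg (· ≫ α.hom.app (regular H M)) h1).trans ?_)
  refine (Category.assoc _ _ _).trans (Eq.trans ?_ h4)
  exact congrArg (· ≫ G.map (functorAction F (regular H M)) ≫ α.hom.app (regular H M))
    (functorAction_tensor G (regular H M).toFDMod (F.obj (regular H M)))

/-- The isomorphism `F(M) ⊗_N G(N) ≅ G(F(M)) ≅ M` is composed of morphisms of right `M`-modules in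
`Rep(H)`, so only the left action needs an argument. -/
theorem tensorIsoRegular_ofFunctor [G.IsEquivalence] (α : F ⋙ G ≅ 𝟭 (RightModRep H M))
    (hα : ∀ (X : FDMod H) V, G.map (μₗ F X V) ≫ α.hom.app (X ⊙ₗ V) =
      δₗ G X (F.obj V) ≫ X ⊴ₗ α.hom.app V) :
    (ofFunctor F).TensorIsoRegular (ofFunctor G) := by
  have := isIso_evalFunctorHom G (F.obj (regular H M))
  let i : (ofFunctor G).tensor (F.obj (regular H M)) ≅ regular H M :=
    asIso (evalFunctorHom G (F.obj (regular H M))) ≪≫ α.app (regular H M)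
  let e : BalancedTensor (ofFunctor F).ract (ofFunctor G).lact ≃ₗ[ℂ] M :=
    LinearEquiv.ofLinearMap (toLin i.hom) (toLin i.inv)
      (LinearMap.ext fun x => RightModRep.congr_toLin i.inv_hom_id x)
      (LinearMap.ext fun x => RightModRep.congr_toLin i.hom_inv_id x)
  refine ⟨e, fun m p q => ?_, fun p q m => ?_, fun h p q => ?_⟩
  · exact RightModRep.congr_toLin (functorAction_comp α hα) ((m ⊗ₜ[ℂ] p) ⊗ₜ[ℂ] q)
  · exact toLin_ract i.hom (balancedMk (ofFunctor F).ract (ofFunctor G).lact p q) m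
  · exact (toLin_ρ i.hom h (balancedMk (ofFunctor F).ract (ofFunctor G).lact p q)).symm

end BimoduleRep

theorem ModuleAlgebra.TopologicallyEquivalent.equivariantlyMoritaEquivalent
    [FiniteDimensional ℂ N] (h : ModuleAlgebra.TopologicallyEquivalent H M N) :
    ModuleAlgebra.EquivariantlyMoritaEquivalent H M N := by
  obtain ⟨F, _, _, _, ⟨hF⟩⟩ := h
  let E := F.asEquivalence
  have : E.functor.LeftLinear (FDMod H) := hF
  let α : E.functor ⋙ E.inverse ≅ 𝟭 _ := E.unitIso.symm
  exact ⟨BimoduleRep.ofFunctor E.functor, BimoduleRep.ofFunctor E.inverse,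
    BimoduleRep.tensorIsoRegular_ofFunctor α (map_μₗ_comp_unitComponent E),
    BimoduleRep.tensorIsoRegular_ofFunctor E.counitIso (map_μₗ_comp_counitComponent E)⟩

end ModuleConverse

end HopfBoundary

end

theorem mainTheorem5 (H : Type u) [Ring H] [HopfAlgebra ℂ H] [FiniteDimensional ℂ H] :
    (∀ (A B : Type u) [Ring A] [Algebra ℂ A] [FiniteDimensional ℂ A]
        [HopfBoundary.ComoduleAlgebra H A]
        [Ring B] [Algebra ℂ B] [FiniteDimensional ℂ B] [HopfBoundary.ComoduleAlgebra H B],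
        HopfBoundary.ComoduleAlgebra.TopologicallyEquivalent H A B ↔
          HopfBoundary.ComoduleAlgebra.EquivariantlyMoritaEquivalent H A B) ∧
      (∀ (M N : Type u) [Ring M] [Algebra ℂ M] [FiniteDimensional ℂ M]
        [HopfBoundary.ModuleAlgebra H M]
        [Ring N] [Algebra ℂ N] [FiniteDimensional ℂ N] [HopfBoundary.ModuleAlgebra H N],
        HopfBoundary.ModuleAlgebra.TopologicallyEquivalent H M N ↔
          HopfBoundary.ModuleAlgebra.EquivariantlyMoritaEquivalent H M N) :=
  ⟨fun _ _ _ _ _ _ _ _ _ _ =>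
    ⟨HopfBoundary.ComoduleAlgebra.TopologicallyEquivalent.equivariantlyMoritaEquivalent,
      HopfBoundary.ComoduleAlgebra.EquivariantlyMoritaEquivalent.topologicallyEquivalent⟩,
    fun _ _ _ _ _ _ _ _ _ _ =>
    ⟨HopfBoundary.ModuleAlgebra.TopologicallyEquivalent.equivariantlyMoritaEquivalent,
      HopfBoundary.ModuleAlgebra.EquivariantlyMoritaEquivalent.topologicallyEquivalent⟩⟩
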